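/- Let $\|\cdot\|$ denote the spectral norm. For $k$-dimensional subspaces $U,W\subseteq\mathbb C^n$ ($k\ge1$), let $\angle(U,W)\in[0,\pi/2]$ denote their largest principal angle, i.e. $\cos\angle(U,W)=\min_{u\in U,\ \|u\|_2=1}\|P_Wu\|_2$ with $P_W$ the orthogonal projector onto $W$; for matrices with linearly independent columns, $\angle$ refers to their column spaces. Let $1\le k<l<n$, let $B\in\mathbb C^{n\times n}$ be Hermitian positive definite with eigenvalues $\sigma_1\ge\sigma_2\ge\dots\ge\sigma_n>0$ and corresponding orthonormal eigenvectors $v_1,\dots,v_n$, and put $V=[v_1,\dots,v_n]$, $V_k=[v_1,\dots,v_k]$. Let $X\in\mathbb C^{n\times k}$ satisfy $X^*X=I_k$, and write $$X=V\begin{bmatrix}X_k\\X_{l\backslash k}\\X_l^{\perp}\end{bmatrix},\qquad X_k\in\mathbb C^{k\times k},\quad X_{l\backslash k}\in\mathbb C^{(l-k)\times k},\quad X_l^{\perp}\in\mathbb C^{(n-l)\times k},$$ where $X_k$ is assumed nonsingular. Put $$\tilde\eta=\|X_l^{\perp}X_k^{-1}\|,\qquad \hat\eta=\|XX_k^{-1}\|.$$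 Let $X_{\mathrm{exp}}\in\mathbb C^{n\times(l-k)}$ be close to $[v_{k+1},\dots,v_l]$ in the sense that $$X_{\mathrm{exp}}=V\left(\begin{bmatrix}0\\I_{l-k}\\0\end{bmatrix}+\varepsilon_{\mathrm{exp}}\Delta\right),\qquad \varepsilon_{\mathrm{exp}}\ge0,\quad \|\Delta\|=1 .$$ For all real $M_\eta,M_\alpha$ there are constants $c,K>0$, depending only on $M_\eta$ and $M_\alpha$, such that for all data as above (of any sizes $k,l,n$) the following holds. Suppose that $$0<\tilde\eta<1,\qquad \hat\eta\le M_\eta,\qquad \varepsilon_{\mathrm{exp}}\le c\,\tilde\eta,\qquad \varepsilon_{\mathrm{exp}}\le c\,\frac{1-\tilde\eta^2}{2}.$$ Then the subspace $\mathcal S$ spanned by the columns of $X$ and $X_{\mathrm{exp}}$ has dimension $l$. Moreover, perform the Rayleigh–Ritz process for $B$ on $\mathcal S$: take an orthonormal basis $Y\in\mathbb C^{n\times l}$ of $\mathcal S$ and a spectral decomposition $Y^*BY=C\,\mathrm{diag}(\theta_1,\dots,\theta_l)\,C^*$ with $C$ unitary and $\theta_1\ge\dots\ge\theta_l$, and let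 $\breve X\in\mathbb C^{n\times k}$ consist of the first $k$ columns of $YC$, i.e. the Ritz vectors belonging to the $k$ largest Ritz values. If for some $\alpha>0$ $$\min_{1\le i\le k}\theta_i>\max_{k<j\le l}\sigma_j+\alpha\qquad\text{and}\qquad \frac{\sigma_1}{\alpha}\le M_\alpha,$$ then $0<\angle(V_k,\breve X)<\pi/2$, $\angle(V_k,B\breve X)<\pi/2$, and $$\frac{\tan\angle(V_k,B\breve X)}{\tan\angle(V_k,\breve X)}\le\frac{\sigma_{l+1}}{\sigma_k}+\frac{\sigma_{k+1}-\sigma_{l+1}}{\sigma_k}\cdot K\,\varepsilon_{\mathrm{exp}} .$$ -/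

import Mathlib

open scoped Matrix Matrix.Norms.L2Operator ComplexOrder

noncomputable section

namespace ShrinkExpand

/-- The first `k` rows of a matrix with `n` rows. -/
def leadRows {n m k : ℕ} (hk : k ≤ n) (A : Matrix (Fin n) (Fin m) ℂ) :
    Matrix (Fin k) (Fin m) ℂ :=
  fun i j => A (Fin.castLE hk i) j

/-- The last `n - l` rows of a matrix with `n` rows. -/
def tailRows {n m : ℕ} (l : ℕ) (A : Matrix (Fin n) (Fin m) ℂ) :
    Matrix (Fin (n - l)) (Fin m) ℂ :=
  fun i j => A ⟨l + i.1, by omega⟩ j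

/-- The first `k` columns of a matrix with `m` columns. -/
def leadCols {n m k : ℕ} (hk : k ≤ m) (A : Matrix (Fin n) (Fin m) ℂ) :
    Matrix (Fin n) (Fin k) ℂ :=
  fun i j => A i (Fin.castLE hk j)

/-- The `n × (l - k)` block column `[0; I; 0]` with block rows of heights `k`, `l - k`, `n - l`. -/
def midUnit (n k l : ℕ) : Matrix (Fin n) (Fin (l - k)) ℂ :=
  fun i j => if i.1 = k + j.1 then 1 else 0

/-- The subspace of `ℂⁿ` spanned by the columns of a matrix. -/
def colSpan {n m : ℕ} (A : Matrix (Fin n) (Fin m) ℂ) :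
    Submodule ℂ (EuclideanSpace ℂ (Fin n)) :=
  Submodule.span ℂ (Set.range fun j : Fin m => WithLp.toLp 2 fun i => A i j)

/-- The largest principal angle between two subspaces of the same dimension: the largest angle
between a unit vector `u` of `U` and the subspace `W`, where the cosine of the angle between
`u` and `W` is the norm of the orthogonal projection of `u` onto `W`. -/
def principalAngle {n : ℕ} (U W : Submodule ℂ (EuclideanSpace ℂ (Fin n))) : ℝ :=
  Real.arccos
    (sInf {c : ℝ | ∃ u : EuclideanSpace ℂ (Fin n), u ∈ U ∧ ‖u‖ = 1 ∧ c = ‖W.starProjection u‖})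

/-- `(θ, Z)` is a result of the Rayleigh--Ritz process for `B` on the subspace `S`:
for an orthonormal basis of `S` (the columns of `Y`), the projected matrix `Yᴴ B Y` has a spectral
decomposition `C diag(θ) Cᴴ` with the Ritz values `θ` in non-increasing order, and the
Ritz vectors are the columns of `Z = Y C`. -/
def IsRayleighRitz {n m : ℕ} (B : Matrix (Fin n) (Fin n) ℂ)
    (S : Submodule ℂ (EuclideanSpace ℂ (Fin n))) (θ : Fin m → ℝ)
    (Z : Matrix (Fin n) (Fin m) ℂ) : Prop :=
  ∃ (Y : Matrix (Fin n) (Fin m) ℂ) (C : Matrix (Fin m) (Fin m) ℂ),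
    Yᴴ * Y = 1 ∧ colSpan Y = S ∧ C ∈ Matrix.unitaryGroup (Fin m) ℂ ∧ Antitone θ ∧
      Yᴴ * B * Y = C * Matrix.diagonal (fun i => (θ i : ℂ)) * Cᴴ ∧ Z = Y * C

end ShrinkExpand

end

/-! Let `P 0`, `P 1`, `P 2` be the spectral projections of `B` onto the eigenvector blocks of sizes
`k`, `l - k`, `n - l`. Normalise `X` to `A = X X_k⁻¹`, so that its first component is isometric, and
let `D` be `X_exp`. For small `ε` every `w = A c + D y` in the search space satisfies `‖P 2 w‖ ≤ 2‖P
0 w‖ + 4ε‖P 1 w‖` (`IsExpansion.thd_le`). Hence the search space is a graph over the first two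
blocks: it has dimension `l`, and it contains vectors with no first component, any given second
component and an `O(ε)` third component (`IsExpansion.exists_mem_snd_eq`).

Testing the Galerkin condition of the Ritz vectors `Z` against these vectors gives a perturbed
Sylvester equation for `P 1 Z`. The gap `α` makes it solvable with a bound, so `‖P 1 Z‖` is at most
a multiple of `ε` times any bound on `‖P 2 Z‖` (`norm_snd_ritz_le`), in particular `O(ε tan φ)`.

Now apply `B`. On the orthogonal complement of `V_k` it costs the factor `σ_{l+1}`, plus the excess
`σ_{k+1} - σ_{l+1}` on the second block only, where `Z` is `O(ε tan φ)`; on `V_k` it gains at least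
`σ_k`. The quotient is the claimed rate (`tan_principalAngle_ritz_le`). The angle `φ` is positive
because `φ = 0` would put `V_k` inside the search space, forcing `η̃ ≤ 4 ε M` for a bound `M` on
`η̂`, which the choice of `c` excludes. -/

namespace ShrinkExpand

/-! ### Tangent of the largest principal angle as a bound on component ratios. -/

section PrincipalAngle

variable {n : ℕ} {U W : Submodule ℂ (EuclideanSpace ℂ (Fin n))}

/-- The set of cosines of the angles between unit vectors of `U` and the subspace `W`. -/
abbrev cosineSet (U W : Submodule ℂ (EuclideanSpace ℂ (Fin n))) : Set ℝ :=
  {c : ℝ | ∃ u : EuclideanSpace ℂ (Fin n), u ∈ U ∧ ‖u‖ = 1 ∧ c = ‖W.starProjection u‖}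

theorem cosineSet_nonempty (hU : U ≠ ⊥) : (cosineSet U W).Nonempty := by
  obtain ⟨u, hu, hu0⟩ := U.exists_mem_ne_zero_of_ne_bot hU
  refine ⟨_, ((‖u‖⁻¹ : ℝ) : ℂ) • u, U.smul_mem _ hu, ?_, rfl⟩
  rw [norm_smul, Complex.norm_real, norm_inv, norm_norm, inv_mul_cancel₀ (norm_ne_zero_iff.2 hu0)]

theorem cosineSet_bddBelow : BddBelow (cosineSet U W) :=
  ⟨0, by rintro _ ⟨u, -, -, rfl⟩; exact norm_nonneg _⟩

theorem sInf_cosineSet_le_one (hU : U ≠ ⊥) : sInf (cosineSet U W) ≤ 1 := by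
  obtain ⟨c, hc⟩ := cosineSet_nonempty (W := W) hU
  refine (csInf_le cosineSet_bddBelow hc).trans ?_
  obtain ⟨u, -, hu, rfl⟩ := hc
  exact hu ▸ W.norm_starProjection_apply_le u

theorem sInf_cosineSet_mul_norm_le {u : EuclideanSpace ℂ (Fin n)} (hu : u ∈ U) :
    sInf (cosineSet U W) * ‖u‖ ≤ ‖W.starProjection u‖ := by
  rcases eq_or_ne u 0 with rfl | hu0
  · simp
  have hpos : 0 < ‖u‖ := norm_pos_iff.2 hu0
  have hmem : ‖W.starProjection (((‖u‖⁻¹ : ℝ) : ℂ) • u)‖ ∈ cosineSet U W := by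
    refine ⟨_, U.smul_mem _ hu, ?_, rfl⟩
    rw [norm_smul, Complex.norm_real, norm_inv, norm_norm, inv_mul_cancel₀ hpos.ne']
  have h := csInf_le cosineSet_bddBelow hmem
  rw [map_smul, norm_smul, Complex.norm_real, norm_inv, norm_norm, inv_mul_eq_div,
    le_div_iff₀ hpos] at h
  exact h

theorem norm_sq_eq_starProjection_add (U : Submodule ℂ (EuclideanSpace ℂ (Fin n)))
    (w : EuclideanSpace ℂ (Fin n)) :
    ‖w‖ ^ 2 = ‖U.starProjection w‖ ^ 2 + ‖w - U.starProjection w‖ ^ 2 := by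
  have h := norm_add_sq_eq_norm_sq_add_norm_sq_of_inner_eq_zero (𝕜 := ℂ)
    (U.starProjection w) (w - U.starProjection w)
    ((U.mem_orthogonal _).1 (U.sub_starProjection_mem_orthogonal w) _
      (U.starProjection_apply_mem w))
  rw [add_sub_cancel] at h
  nlinarith

/-- An injective map between spaces of equal finite dimension is onto. This is what makes the
principal angle usable in both directions. -/
theorem exists_mem_starProjection_eq (hdim : Module.finrank ℂ U = Module.finrank ℂ W)
    (hinj : ∀ w ∈ W, U.starProjection w = 0 → w = 0) {u : EuclideanSpace ℂ (Fin n)} (hu : u ∈ U) :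
    ∃ w ∈ W, U.starProjection w = u := by
  let f : W →ₗ[ℂ] U := (U.orthogonalProjectionOnto.toLinearMap).comp W.subtype
  have hf : Function.Injective f := by
    rw [injective_iff_map_eq_zero]
    intro w hw
    exact Subtype.ext (hinj w w.2 (congrArg Subtype.val hw))
  obtain ⟨w, hw⟩ := (LinearMap.injective_iff_surjective_of_finrank_eq_finrank hdim.symm).1 hf ⟨u, hu⟩
  exact ⟨w, w.2, congrArg Subtype.val hw⟩

/-- If the component of each vector of `W` orthogonal to `U` is at most `t` times its component
in `U`, then the tangent of the largest principal angle is at most `t`. -/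
theorem tan_principalAngle_le (hU : U ≠ ⊥) (hdim : Module.finrank ℂ U = Module.finrank ℂ W)
    {t : ℝ} (ht : 0 ≤ t)
    (h : ∀ w ∈ W, ‖w - U.starProjection w‖ ≤ t * ‖U.starProjection w‖) :
    principalAngle U W < Real.pi / 2 ∧ Real.tan (principalAngle U W) ≤ t := by
  have hle : principalAngle U W ≤ Real.arctan t := by
    have harc : Real.arccos (Real.cos (Real.arctan t)) = Real.arctan t :=
      Real.arccos_cos (Real.arctan_nonneg.2 ht)
        ((Real.arctan_lt_pi_div_two t).le.trans (by linarith [Real.pi_pos]))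
    rw [← harc]
    refine Real.arccos_le_arccos (le_csInf (cosineSet_nonempty hU) ?_)
    rintro _ ⟨u, hu, hu1, rfl⟩
    -- Lift the unit vector `u` to `w ∈ W` with `P_U w = u`. Then `1 = ⟪u, w⟫ = ⟪P_W u, w⟫ ≤ ‖P_W u‖
    -- ‖w‖`, while `‖w‖ ≤ √(1 + t²) = 1 / cos (arctan t)`.
    obtain ⟨w, hw, rfl⟩ := exists_mem_starProjection_eq hdim (fun w hw h0 => by
      have := h w hw
      rw [h0, norm_zero, mul_zero, sub_zero] at this
      exact norm_le_zero_iff.1 this) hu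
    have h2 := norm_sq_eq_starProjection_add U w
    have h3 := h w hw
    rw [hu1] at h2 h3
    have h4 : ‖w‖ ≤ √(1 + t ^ 2) := by
      refine Real.le_sqrt_of_sq_le ?_
      nlinarith [norm_nonneg (w - U.starProjection w)]
    have h5 : (1 : ℝ) ≤ ‖W.starProjection (U.starProjection w)‖ * ‖w‖ := by
      have e1 : inner ℂ (U.starProjection w) w =
          inner ℂ (W.starProjection (U.starProjection w)) w := by
        rw [W.inner_starProjection_left_eq_right, W.starProjection_eq_self_iff.2 hw]
      have e2 : inner ℂ (U.starProjection w) w =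
          inner ℂ (U.starProjection w) (U.starProjection w) := by
        rw [U.inner_starProjection_left_eq_right, U.inner_starProjection_left_eq_right,
          U.starProjection_eq_self_iff.2 (U.starProjection_apply_mem w)]
      have := norm_inner_le_norm (𝕜 := ℂ) (W.starProjection (U.starProjection w)) w
      rw [← e1, e2, inner_self_eq_norm_sq_to_K, hu1] at this
      simpa using this
    rw [Real.cos_arctan, div_le_iff₀ (by positivity)]
    exact h5.trans (mul_le_mul_of_nonneg_left h4 (norm_nonneg _))
  have hlt := hle.trans_lt (Real.arctan_lt_pi_div_two t)
  refine ⟨hlt, ?_⟩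
  have h0 : 0 ≤ principalAngle U W := Real.arccos_nonneg _
  have hmem : principalAngle U W ∈ Set.Ioo (-(Real.pi / 2)) (Real.pi / 2) :=
    ⟨by linarith [Real.pi_pos], hlt⟩
  calc Real.tan (principalAngle U W) ≤ Real.tan (Real.arctan t) :=
        Real.strictMonoOn_tan.monotoneOn hmem
          ⟨Real.neg_pi_div_two_lt_arctan t, Real.arctan_lt_pi_div_two t⟩ hle
    _ = t := Real.tan_arctan t

/-- The component of each vector of `W` orthogonal to `U` is at most the tangent of the largest
principal angle times its component in `U`. -/
theorem norm_sub_starProjection_le_tan (hU : U ≠ ⊥)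
    (hdim : Module.finrank ℂ U = Module.finrank ℂ W)
    (hlt : principalAngle U W < Real.pi / 2) {w : EuclideanSpace ℂ (Fin n)} (hw : w ∈ W) :
    ‖w - U.starProjection w‖ ≤ Real.tan (principalAngle U W) * ‖U.starProjection w‖ := by
  set φ := principalAngle U W with hφ
  have h0 : 0 ≤ φ := Real.arccos_nonneg _
  have hpos : 0 < sInf (cosineSet U W) := Real.arccos_lt_pi_div_two.1 hlt
  have hcos : Real.cos φ = sInf (cosineSet U W) :=
    Real.cos_arccos (by linarith) (sInf_cosineSet_le_one hU)
  rw [← hcos] at hpos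
  -- The angle is defined by projecting `U` to `W`; this is the reverse direction. Writing `w = P_W
  -- u` gives `‖w‖² = ⟪u, P_U w⟫ ≤ ‖u‖ ‖P_U w‖`, and `cos φ ‖u‖ ≤ ‖w‖`.
  have hproj : Real.cos φ * ‖w‖ ≤ ‖U.starProjection w‖ := by
    obtain ⟨u, hu, rfl⟩ := exists_mem_starProjection_eq hdim.symm (fun u hu hz => by
      have := sInf_cosineSet_mul_norm_le (W := W) hu
      rw [hz, norm_zero, ← hcos] at this
      exact norm_le_zero_iff.1 (nonpos_of_mul_nonpos_right this hpos)) hw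
    have h1 := sInf_cosineSet_mul_norm_le (W := W) hu
    rw [← hcos] at h1
    set w := W.starProjection u
    have e : inner ℂ w w = inner ℂ u (U.starProjection w) := by
      rw [← U.inner_starProjection_left_eq_right, U.starProjection_eq_self_iff.2 hu,
        W.inner_starProjection_left_eq_right, W.starProjection_eq_self_iff.2 hw]
    have h2 := norm_inner_le_norm (𝕜 := ℂ) u (U.starProjection w)
    rw [← e, inner_self_eq_norm_sq_to_K] at h2
    have h3 : ‖w‖ ^ 2 ≤ ‖u‖ * ‖U.starProjection w‖ := by simpa using h2
    rcases eq_or_ne w 0 with hw0 | hw0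
    · rw [hw0]; simp
    have hwpos : 0 < ‖w‖ := norm_pos_iff.2 hw0
    have h4 : Real.cos φ * ‖w‖ ^ 2 ≤ ‖w‖ * ‖U.starProjection w‖ := by
      calc Real.cos φ * ‖w‖ ^ 2 ≤ Real.cos φ * (‖u‖ * ‖U.starProjection w‖) := by gcongr
        _ = (Real.cos φ * ‖u‖) * ‖U.starProjection w‖ := by ring
        _ ≤ _ := by gcongr
    nlinarith
  have hsin : 0 ≤ Real.sin φ :=
    Real.sin_nonneg_of_nonneg_of_le_pi h0 (by linarith [Real.pi_pos])
  rw [Real.tan_eq_sin_div_cos, div_mul_eq_mul_div, le_div_iff₀ hpos]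
  refine abs_le_of_sq_le_sq' ?_ (by positivity) |>.2
  have h5 := norm_sq_eq_starProjection_add U w
  have h6 := Real.sin_sq_add_cos_sq φ
  have h7 : (Real.cos φ * ‖w‖) ^ 2 ≤ ‖U.starProjection w‖ ^ 2 := by gcongr
  have h8 : ‖w - U.starProjection w‖ ^ 2 = ‖w‖ ^ 2 - ‖U.starProjection w‖ ^ 2 := by linarith
  have h9 : Real.sin φ ^ 2 = 1 - Real.cos φ ^ 2 := by linarith
  rw [mul_pow, mul_pow, h8, h9]
  nlinarith

end PrincipalAngle

/-! ### Three-block decompositions, expanded search spaces, and the Sylvester bound. -/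

section Resolution

variable {E F G : Type*} [NormedAddCommGroup E] [InnerProductSpace ℂ E]
  [NormedAddCommGroup F] [InnerProductSpace ℂ F] [NormedAddCommGroup G] [InnerProductSpace ℂ G]

/-- Three pairwise orthogonal orthogonal projections that add up to the identity. -/
structure IsOrthogonalResolution (P : Fin 3 → E →L[ℂ] E) : Prop where
  add : ∀ x, P 0 x + P 1 x + P 2 x = x
  symm : ∀ i x y, inner ℂ (P i x) y = inner ℂ x (P i y)
  idem : ∀ i x, P i (P i x) = P i x
  ortho : ∀ i j x, i ≠ j → P i (P j x) = 0

variable {P : Fin 3 → E →L[ℂ] E}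

namespace IsOrthogonalResolution

theorem inner_proj (hP : IsOrthogonalResolution P) (i : Fin 3) (x y : E) :
    inner ℂ (P i x) y = inner ℂ (P i x) (P i y) := by
  rw [← hP.symm, hP.idem]

theorem norm_proj_le (hP : IsOrthogonalResolution P) (i : Fin 3) (x : E) : ‖P i x‖ ≤ ‖x‖ := by
  have h1 : inner ℂ (P i x) x = inner ℂ (P i x) (P i x) := hP.inner_proj i x x
  have h2 := norm_inner_le_norm (𝕜 := ℂ) (P i x) x
  rw [h1, inner_self_eq_norm_sq_to_K] at h2
  have h3 : ‖P i x‖ ^ 2 ≤ ‖P i x‖ * ‖x‖ := by simpa using h2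
  rcases (norm_nonneg (P i x)).eq_or_lt with h | h
  · rw [← h]; exact norm_nonneg x
  · nlinarith

theorem norm_le_add (hP : IsOrthogonalResolution P) (x : E) :
    ‖x‖ ≤ ‖P 0 x‖ + ‖P 1 x‖ + ‖P 2 x‖ := by
  conv_lhs => rw [← hP.add x]
  exact norm_add₃_le

theorem norm_add_sq (hP : IsOrthogonalResolution P) {i j : Fin 3} (hij : i ≠ j) (x y : E) :
    ‖P i x + P j y‖ ^ 2 = ‖P i x‖ ^ 2 + ‖P j y‖ ^ 2 := by
  have h := norm_add_sq_eq_norm_sq_add_norm_sq_of_inner_eq_zero (𝕜 := ℂ) (P i x) (P j y)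
    (by rw [hP.symm, hP.ortho i j _ hij, inner_zero_right])
  simpa only [sq] using h

end IsOrthogonalResolution

/-- A pair of maps `A : F → E`, `D : G → E` spanning the expanded search space: `A` is the identity
in the first component, bounded, and has a third component smaller than `1`; `D` is `ε`-close to an
isometric embedding into the second component. -/
structure IsExpansion (P : Fin 3 → E →L[ℂ] E) (A : F →L[ℂ] E) (D : G →L[ℂ] E)
    (M ε : ℝ) : Prop where
  one_le : 1 ≤ M
  eps_nonneg : 0 ≤ ε
  eps_mul_le : 4 * (ε * M) ≤ 1
  fst_left : ∀ c, ‖P 0 (A c)‖ = ‖c‖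
  norm_left : ∀ c, ‖A c‖ ≤ M * ‖c‖
  thd_left : ∀ c, ‖P 2 (A c)‖ ≤ ‖c‖
  fst_right : ∀ y, ‖P 0 (D y)‖ ≤ ε * ‖y‖
  snd_right : ∀ y, ‖y‖ ≤ ‖P 1 (D y)‖ + ε * ‖y‖
  thd_right : ∀ y, ‖P 2 (D y)‖ ≤ ε * ‖y‖

namespace IsExpansion

variable {A : F →L[ℂ] E} {D : G →L[ℂ] E} {M ε : ℝ}

/-- The first two components give a nearly triangular system, `‖c‖ ≤ a + ε‖y‖` and `‖y‖ ≤ b + M‖c‖ +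
ε‖y‖`. Eliminating one unknown from the other works because `4εM ≤ 1`, and `4ε ≤ 1` follows from `M
≥ 1`. -/
theorem coord_le (hP : IsOrthogonalResolution P) (h : IsExpansion P A D M ε) (c : F) (y : G) :
    ‖c‖ ≤ 3 / 2 * ‖P 0 (A c + D y)‖ + 2 * ε * ‖P 1 (A c + D y)‖ ∧
      ‖y‖ ≤ 2 * M * ‖P 0 (A c + D y)‖ + 2 * ‖P 1 (A c + D y)‖ := by
  have hM := h.one_le
  have hε := h.eps_nonneg
  have hεM := h.eps_mul_le
  have h4 : 4 * ε ≤ 1 := by nlinarith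
  have h1 : ‖c‖ ≤ ‖P 0 (A c + D y)‖ + ε * ‖y‖ := by
    have e : P 0 (A c) = P 0 (A c + D y) - P 0 (D y) := by rw [map_add, add_sub_cancel_right]
    rw [← h.fst_left c, e]
    exact (norm_sub_le _ _).trans (by gcongr; exact h.fst_right y)
  have h2 : ‖y‖ ≤ ‖P 1 (A c + D y)‖ + M * ‖c‖ + ε * ‖y‖ := by
    have e : P 1 (D y) = P 1 (A c + D y) - P 1 (A c) := by rw [map_add, add_sub_cancel_left]
    have h3 := h.snd_right y
    rw [e] at h3
    have h5 := norm_sub_le (P 1 (A c + D y)) (P 1 (A c))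
    have h6 := (hP.norm_proj_le 1 (A c)).trans (h.norm_left c)
    linarith
  set a := ‖P 0 (A c + D y)‖
  set b := ‖P 1 (A c + D y)‖
  have ha : 0 ≤ a := norm_nonneg _
  have hb : 0 ≤ b := norm_nonneg _
  have hc : 0 ≤ ‖c‖ := norm_nonneg _
  have hy : 0 ≤ ‖y‖ := norm_nonneg _
  have h3 : 3 * ‖y‖ ≤ 4 * (b + M * ‖c‖) := by nlinarith
  have h5 : ‖c‖ ≤ 3 / 2 * a + 2 * ε * b := by
    have e1 : ε * (3 * ‖y‖) ≤ ε * (4 * (b + M * ‖c‖)) := by gcongr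
    have e2 : 4 * (ε * M) * ‖c‖ ≤ 1 * ‖c‖ := by gcongr
    nlinarith
  refine ⟨h5, ?_⟩
  have e1 : M * ‖c‖ ≤ M * (3 / 2 * a + 2 * ε * b) := by gcongr
  have e2 : 4 * (ε * M) * b ≤ 1 * b := by gcongr
  nlinarith

theorem thd_le (hP : IsOrthogonalResolution P) (h : IsExpansion P A D M ε) (c : F) (y : G) :
    ‖P 2 (A c + D y)‖ ≤ 2 * ‖P 0 (A c + D y)‖ + 4 * ε * ‖P 1 (A c + D y)‖ := by
  obtain ⟨h1, h2⟩ := h.coord_le hP c y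
  have h3 : ‖P 2 (A c + D y)‖ ≤ ‖c‖ + ε * ‖y‖ := by
    rw [map_add]
    exact (norm_add_le _ _).trans (add_le_add (h.thd_left c) (h.thd_right y))
  have e1 : ε * ‖y‖ ≤ ε * (2 * M * ‖P 0 (A c + D y)‖ + 2 * ‖P 1 (A c + D y)‖) :=
    mul_le_mul_of_nonneg_left h2 h.eps_nonneg
  have e2 : 4 * (ε * M) * ‖P 0 (A c + D y)‖ ≤ 1 * ‖P 0 (A c + D y)‖ :=
    mul_le_mul_of_nonneg_right h.eps_mul_le (norm_nonneg _)
  nlinarith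

variable {S : Submodule ℂ E}

theorem thd_le_of_mem (hP : IsOrthogonalResolution P) (h : IsExpansion P A D M ε)
    (hS : ∀ w ∈ S, ∃ c y, w = A c + D y) {w : E} (hw : w ∈ S) :
    ‖P 2 w‖ ≤ 2 * ‖P 0 w‖ + 4 * ε * ‖P 1 w‖ := by
  obtain ⟨c, y, rfl⟩ := hS w hw
  exact h.thd_le hP c y

theorem finrank_eq [FiniteDimensional ℂ F] [FiniteDimensional ℂ G]
    (hP : IsOrthogonalResolution P) (h : IsExpansion P A D M ε)
    (hS : ∀ w, w ∈ S ↔ ∃ c y, w = A c + D y) :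
    Module.finrank ℂ S = Module.finrank ℂ F + Module.finrank ℂ G := by
  let f : F × G →ₗ[ℂ] E := A.toLinearMap.coprod D.toLinearMap
  have hf : Function.Injective f := by
    rw [injective_iff_map_eq_zero]
    rintro ⟨c, y⟩ hcy
    have h0 : A c + D y = 0 := hcy
    obtain ⟨h1, h2⟩ := h.coord_le hP c y
    simp only [h0, map_zero, norm_zero, mul_zero, add_zero, norm_le_zero_iff] at h1 h2
    rw [h1, h2]; rfl
  have hr : S = LinearMap.range f := by
    ext w
    rw [hS, LinearMap.mem_range]
    exact ⟨fun ⟨c, y, e⟩ => ⟨(c, y), e.symm⟩, fun ⟨⟨c, y⟩, e⟩ => ⟨c, y, e.symm⟩⟩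
  rw [hr, LinearMap.finrank_range_of_inj hf, Module.finrank_prod]

/-- If `S` has the dimension of the sum of the first two components, it contains a vector with
vanishing first and prescribed second component, and its third component is small. -/
theorem exists_mem_snd_eq [FiniteDimensional ℂ E] (hP : IsOrthogonalResolution P)
    (h : IsExpansion P A D M ε) (hS : ∀ w ∈ S, ∃ c y, w = A c + D y)
    (hdim : Module.finrank ℂ (LinearMap.range (P 0 + P 1).toLinearMap) ≤ Module.finrank ℂ S)
    (x : E) : ∃ w ∈ S, P 0 w = 0 ∧ P 1 w = P 1 x ∧ ‖P 2 w‖ ≤ 4 * ε * ‖P 1 x‖ := by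
  let f : S →ₗ[ℂ] LinearMap.range (P 0 + P 1).toLinearMap :=
    ((P 0 + P 1).toLinearMap.rangeRestrict).comp S.subtype
  have hsplit : ∀ w : E, P 0 ((P 0 + P 1) w) = P 0 w ∧ P 1 ((P 0 + P 1) w) = P 1 w := fun w => by
    constructor
    · rw [_root_.add_apply, map_add, hP.idem, hP.ortho 0 1 _ (by decide), add_zero]
    · rw [_root_.add_apply, map_add, hP.idem, hP.ortho 1 0 _ (by decide), zero_add]
  have hf : Function.Injective f := by
    rw [injective_iff_map_eq_zero]
    rintro ⟨w, hw⟩ h0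
    have h1 : (P 0 + P 1) w = 0 := congrArg Subtype.val h0
    have h2 : P 0 w = 0 := by rw [← (hsplit w).1, h1, map_zero]
    have h3 : P 1 w = 0 := by rw [← (hsplit w).2, h1, map_zero]
    have h4 := h.thd_le_of_mem hP hS hw
    have h5 := hP.norm_le_add w
    rw [h2, h3] at h4 h5
    simp only [norm_zero, mul_zero, add_zero, zero_add] at h4 h5
    exact Subtype.ext (norm_le_zero_iff.1 (h5.trans h4))
  have hdim' := le_antisymm (LinearMap.finrank_le_finrank_of_injective hf) hdim
  -- By `thd_le_of_mem` the projection of `S` to the first two blocks is injective, hence bijective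
  -- by dimension; `w` is the preimage of `P 1 x`.
  obtain ⟨⟨w, hw⟩, hfw⟩ :=
    (LinearMap.injective_iff_surjective_of_finrank_eq_finrank hdim').1 hf ⟨P 1 x, P 1 x, by
      change (P 0 + P 1) (P 1 x) = P 1 x
      rw [_root_.add_apply, hP.idem, hP.ortho 0 1 _ (by decide), zero_add]⟩
  have h1 : (P 0 + P 1) w = P 1 x := congrArg Subtype.val hfw
  have h2 : P 0 w = 0 := by rw [← (hsplit w).1, h1, hP.ortho 0 1 _ (by decide)]
  have h3 : P 1 w = P 1 x := by rw [← (hsplit w).2, h1, hP.idem]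
  refine ⟨w, hw, h2, h3, ?_⟩
  have h4 := h.thd_le_of_mem hP hS hw
  rwa [h2, h3, norm_zero, mul_zero, zero_add] at h4

/-- If the first component lies in `S`, then the third component of `A` is small. -/
theorem thd_left_le_of_range_le (hP : IsOrthogonalResolution P)
    (h : IsExpansion P A D M ε) (hS : ∀ w, w ∈ S ↔ ∃ c y, w = A c + D y)
    (hsub : ∀ x, P 0 x ∈ S) (c : F) : ‖P 2 (A c)‖ ≤ 4 * ε * M * ‖c‖ := by
  -- Subtracting the first component, now allowed inside `S`, leaves only the `4ε‖P 1 w‖` term in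
  -- `thd_le_of_mem`.
  have hmem : A c - P 0 (A c) ∈ S :=
    S.sub_mem ((hS _).2 ⟨c, 0, by rw [map_zero, add_zero]⟩) (hsub _)
  have h1 := h.thd_le_of_mem hP (fun w hw => (hS w).1 hw) hmem
  simp only [map_sub, hP.idem, hP.ortho 1 0 _ (by decide), hP.ortho 2 0 _ (by decide), sub_self,
    sub_zero, norm_zero, mul_zero, zero_add] at h1
  have h2 := (hP.norm_proj_le 1 (A c)).trans (h.norm_left c)
  have h3 : 4 * ε * ‖P 1 (A c)‖ ≤ 4 * ε * (M * ‖c‖) :=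
    mul_le_mul_of_nonneg_left h2 (by linarith [h.eps_nonneg])
  linarith

end IsExpansion

/-- The second component of the Ritz vectors `Z` is controlled by their third component, by a
Sylvester equation argument. -/
theorem norm_snd_ritz_le (hP : IsOrthogonalResolution P) {S : Submodule ℂ E} {B : E →L[ℂ] E}
    {Z : F →L[ℂ] E} {s₁ s₂ α δ τ m : ℝ}
    (hcomm : ∀ i x, P i (B x) = B (P i x))
    (hB₂ : ∀ x, ‖B (P 1 x)‖ ≤ s₂ * ‖P 1 x‖) (hB₃ : ∀ x, ‖B (P 2 x)‖ ≤ s₁ * ‖P 2 x‖)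
    (hs₂ : 0 ≤ s₂) (hs : s₂ ≤ s₁) (hα : 0 < α) (hδ : 0 ≤ δ) (hτ : 0 ≤ τ) (hm : s₁ ≤ m * α)
    (htest : ∀ x, ∃ w ∈ S, P 0 w = 0 ∧ P 1 w = P 1 x ∧ ‖P 2 w‖ ≤ δ * ‖P 1 x‖)
    (hZ : ∀ c, ∃ c', (s₂ + α) * ‖c'‖ ≤ ‖c‖ ∧ ∀ y ∈ S, inner ℂ y (B (Z c') - Z c) = 0)
    (hthd : ∀ c, ‖P 2 (Z c)‖ ≤ τ * ‖c‖) (c : F) :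
    ‖P 1 (Z c)‖ ≤ δ * (2 * m + 1) * τ * ‖c‖ := by
  have hs₁ : 0 ≤ s₁ := hs₂.trans hs
  have key : ∀ c c' : F, (∀ y ∈ S, inner ℂ y (B (Z c') - Z c) = 0) →
      ‖P 1 (Z c)‖ ≤ s₂ * ‖P 1 (Z c')‖ + δ * (s₁ * (τ * ‖c'‖) + τ * ‖c‖) := by
    intro c c' horth
    -- A test vector without first component removes the dominant block from the Galerkin equation.
    -- What remains is `‖P 1 (Z c)‖²` on one side and, on the other, the Sylvester term plus a
    -- third-block error with factor `δ`.
    obtain ⟨w, hw, hw0, hw1, hw2⟩ := htest (Z c)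
    have h0 := horth w hw
    have hsplit : inner ℂ (P 1 (Z c)) (P 1 (Z c)) =
        inner ℂ (P 1 (Z c)) (B (P 1 (Z c'))) +
          inner ℂ (P 2 w) (B (P 2 (Z c')) - P 2 (Z c)) := by
      conv at h0 => lhs; rw [← hP.add w]
      rw [hw0, zero_add, inner_add_left, hP.inner_proj 1, hP.inner_proj 2 w, hw1] at h0
      simp only [map_sub, hcomm] at h0
      rw [inner_sub_right] at h0
      linear_combination -h0
    have h1 := norm_inner_le_norm (𝕜 := ℂ) (P 1 (Z c)) (B (P 1 (Z c')))
    have h2 := norm_inner_le_norm (𝕜 := ℂ) (P 2 w) (B (P 2 (Z c')) - P 2 (Z c))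
    have h3 : ‖P 1 (Z c)‖ ^ 2 ≤ ‖P 1 (Z c)‖ * ‖B (P 1 (Z c'))‖ +
        ‖P 2 w‖ * ‖B (P 2 (Z c')) - P 2 (Z c)‖ := by
      have := norm_add_le (inner ℂ (P 1 (Z c)) (B (P 1 (Z c'))))
        (inner ℂ (P 2 w) (B (P 2 (Z c')) - P 2 (Z c)))
      rw [← hsplit, inner_self_eq_norm_sq_to_K] at this
      have e : ‖((‖P 1 (Z c)‖ : ℂ)) ^ 2‖ = ‖P 1 (Z c)‖ ^ 2 := by simp
      rw [← e]
      exact this.trans (add_le_add h1 h2)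
    have h4 : ‖B (P 2 (Z c')) - P 2 (Z c)‖ ≤ s₁ * (τ * ‖c'‖) + τ * ‖c‖ := by
      refine (norm_sub_le _ _).trans (add_le_add ((hB₃ _).trans ?_) (hthd c))
      exact mul_le_mul_of_nonneg_left (hthd c') hs₁
    have h5 : ‖P 1 (Z c)‖ ^ 2 ≤ ‖P 1 (Z c)‖ *
        (s₂ * ‖P 1 (Z c')‖ + δ * (s₁ * (τ * ‖c'‖) + τ * ‖c‖)) := by
      calc _ ≤ _ := h3
        _ ≤ ‖P 1 (Z c)‖ * (s₂ * ‖P 1 (Z c')‖) +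
            (δ * ‖P 1 (Z c)‖) * (s₁ * (τ * ‖c'‖) + τ * ‖c‖) := by
          gcongr
          exact hB₂ _
        _ = _ := by ring
    rcases (norm_nonneg (P 1 (Z c))).eq_or_lt with h | h
    · rw [← h]; positivity
    · nlinarith
  have hq : 0 < s₂ + α := by linarith
  set T : F →L[ℂ] E := (P 1).comp Z
  -- `‖T‖` occurs on both sides with weights `s₂ + α` and `s₂`. Absorbing leaves `α‖T‖ ≤ δτ(s₁ + s₂
  -- + α)`, and `s₂ ≤ s₁ ≤ mα` yields the factor `2m + 1`.
  have hT : ‖T‖ ≤ (s₂ * ‖T‖ + δ * (s₁ * τ) + δ * τ * (s₂ + α)) / (s₂ + α) := by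
    refine T.opNorm_le_bound (by positivity) fun c => ?_
    obtain ⟨c', hc', horth⟩ := hZ c
    rw [div_mul_eq_mul_div, le_div_iff₀ hq]
    have h1 : ‖T c‖ ≤ (s₂ * ‖T‖ + δ * (s₁ * τ)) * ‖c'‖ + δ * τ * ‖c‖ := by
      refine (key c c' horth).trans ?_
      have := mul_le_mul_of_nonneg_left (T.le_opNorm c') hs₂
      have e : T c' = P 1 (Z c') := rfl
      rw [e] at this
      linarith
    have h2 : (s₂ * ‖T‖ + δ * (s₁ * τ)) * ((s₂ + α) * ‖c'‖) ≤
        (s₂ * ‖T‖ + δ * (s₁ * τ)) * ‖c‖ := by gcongr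
    nlinarith
  rw [le_div_iff₀ hq] at hT
  have hT2 : α * ‖T‖ ≤ α * (δ * (2 * m + 1) * τ) := by
    have h1 : δ * τ * (s₁ + s₂ + α) ≤ δ * τ * (m * α + m * α + α) := by
      gcongr
      exact hs.trans hm
    nlinarith
  exact (T.le_opNorm c).trans (mul_le_mul_of_nonneg_right (le_of_mul_le_mul_left hT2 hα)
    (norm_nonneg c))

end Resolution

/-! ### The abstract convergence estimate for the Ritz vectors. -/

section RitzAngles

variable {n : ℕ} {F G : Type*} [NormedAddCommGroup F] [InnerProductSpace ℂ F]
  [NormedAddCommGroup G] [InnerProductSpace ℂ G]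

/-- Convergence estimate for one step of subspace iteration applied to the Ritz vectors `Z` of an
expanded search space. -/
theorem tan_principalAngle_ritz_le
    {P : Fin 3 → EuclideanSpace ℂ (Fin n) →L[ℂ] EuclideanSpace ℂ (Fin n)}
    {A Z : F →L[ℂ] EuclideanSpace ℂ (Fin n)} {D : G →L[ℂ] EuclideanSpace ℂ (Fin n)}
    {B : EuclideanSpace ℂ (Fin n) →L[ℂ] EuclideanSpace ℂ (Fin n)}
    {S U : Submodule ℂ (EuclideanSpace ℂ (Fin n))} {M ε m α s₀ s₁ s₂ s₃ : ℝ}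
    (hP : IsOrthogonalResolution P) (hA : IsExpansion P A D M ε)
    (hS : ∀ w, w ∈ S ↔ ∃ c y, w = A c + D y)
    (hdim : Module.finrank ℂ (LinearMap.range (P 0 + P 1).toLinearMap) ≤ Module.finrank ℂ S)
    (hU : ∀ x, U.starProjection x = P 0 x) (hU0 : U ≠ ⊥)
    (hFU : Module.finrank ℂ F = Module.finrank ℂ U)
    (hA₃ : ∃ c, 4 * ε * M * ‖c‖ < ‖P 2 (A c)‖)
    (hcomm : ∀ i x, P i (B x) = B (P i x))
    (hB₁ : ∀ x, s₁ * ‖P 0 x‖ ≤ ‖B (P 0 x)‖)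
    (hB₂ : ∀ x, ‖B (P 1 x) - (s₃ : ℂ) • P 1 x‖ ≤ (s₂ - s₃) * ‖P 1 x‖)
    (hB₃ : ∀ x, ‖B (P 2 x)‖ ≤ s₃ * ‖P 2 x‖)
    (hs₁ : 0 < s₁) (hs₃ : 0 ≤ s₃) (hs₂ : s₃ ≤ s₂) (hs₀ : s₂ ≤ s₀)
    (hα : 0 < α) (hm0 : 0 ≤ m) (hm : s₀ ≤ m * α) (hε : 4 * (2 * m + 1) * ε ≤ 1 / 4)
    (hZn : ∀ c, ‖Z c‖ = ‖c‖) (hZS : ∀ c, Z c ∈ S)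
    (hZ : ∀ c, ∃ c', (s₂ + α) * ‖c'‖ ≤ ‖c‖ ∧ ∀ y ∈ S, inner ℂ y (B (Z c') - Z c) = 0) :
    0 < principalAngle U (LinearMap.range Z.toLinearMap) ∧
      principalAngle U (LinearMap.range Z.toLinearMap) < Real.pi / 2 ∧
      principalAngle U (LinearMap.range (B.comp Z).toLinearMap) < Real.pi / 2 ∧
      Real.tan (principalAngle U (LinearMap.range (B.comp Z).toLinearMap)) /
        Real.tan (principalAngle U (LinearMap.range Z.toLinearMap)) ≤
          s₃ / s₁ + (s₂ - s₃) / s₁ * (24 * (2 * m + 1) * ε) := by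
  have hε0 := hA.eps_nonneg
  have hε4 : 4 * ε ≤ 1 := by nlinarith
  have hS' : ∀ w ∈ S, ∃ c y, w = A c + D y := fun w hw => (hS w).1 hw
  have hB₂' : ∀ x, ‖B (P 1 x)‖ ≤ s₂ * ‖P 1 x‖ := fun x => by
    have h1 := norm_add_le (B (P 1 x) - (s₃ : ℂ) • P 1 x) ((s₃ : ℂ) • P 1 x)
    rw [sub_add_cancel, norm_smul, Complex.norm_real, Real.norm_of_nonneg hs₃] at h1
    linarith [hB₂ x]
  -- Left open in `τ` because it is used twice: with `τ = 1` for an a priori bound, then with `τ`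
  -- the tangent of the angle.
  have hsnd : ∀ τ : ℝ, 0 ≤ τ → (∀ c, ‖P 2 (Z c)‖ ≤ τ * ‖c‖) → ∀ c,
      ‖P 1 (Z c)‖ ≤ 4 * ε * (2 * m + 1) * τ * ‖c‖ := fun τ hτ h c =>
    norm_snd_ritz_le hP hcomm hB₂'
      (fun x => (hB₃ x).trans (mul_le_mul_of_nonneg_right (hs₂.trans hs₀) (norm_nonneg _)))
      (hs₃.trans hs₂) hs₀ hα (by linarith) hτ hm (hA.exists_mem_snd_eq hP hS' hdim) hZ h c
  -- With `‖P 1 (Z c)‖ ≤ ‖c‖/4` and `‖P 2 (Z c)‖ ≤ 2‖P 0 (Z c)‖ + ‖P 1 (Z c)‖`, the triangle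
  -- inequality gives `‖c‖ ≤ 3‖P 0 (Z c)‖ + ‖c‖/2`.
  have hfst : ∀ c, ‖c‖ ≤ 6 * ‖P 0 (Z c)‖ := fun c => by
    have h1 := hsnd 1 zero_le_one
      (fun c => by rw [one_mul, ← hZn c]; exact hP.norm_proj_le 2 _) c
    have h2 := hA.thd_le_of_mem hP hS' (hZS c)
    have h3 := hP.norm_le_add (Z c)
    rw [hZn] at h3
    have h4 : 4 * ε * (2 * m + 1) * 1 * ‖c‖ ≤ 1 / 4 * ‖c‖ := by gcongr; linarith
    have h5 : 4 * ε * ‖P 1 (Z c)‖ ≤ 1 * ‖P 1 (Z c)‖ := by gcongr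
    linarith
  have hsub : ∀ x, x - P 0 x = P 1 x + P 2 x := fun x => by
    rw [sub_eq_iff_eq_add]; conv_lhs => rw [← hP.add x]
    abel
  have hZinj : Function.Injective Z.toLinearMap := by
    rw [injective_iff_map_eq_zero]
    intro c hc
    have h1 : ‖Z c‖ = 0 := by rw [show Z c = 0 from hc, norm_zero]
    exact norm_eq_zero.1 ((hZn c).symm.trans h1)
  have hBZinj : Function.Injective (B.comp Z).toLinearMap := by
    rw [injective_iff_map_eq_zero]
    intro c hc
    have h1 : B (Z c) = 0 := hc
    have h2 := hB₁ (Z c)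
    rw [← hcomm, h1, map_zero, norm_zero] at h2
    have h3 : ‖P 0 (Z c)‖ ≤ 0 := nonpos_of_mul_nonpos_right h2 hs₁
    exact norm_le_zero_iff.1 (by linarith [hfst c])
  have hd1 : Module.finrank ℂ U = Module.finrank ℂ (LinearMap.range Z.toLinearMap) := by
    rw [LinearMap.finrank_range_of_inj hZinj, hFU]
  have hd2 : Module.finrank ℂ U = Module.finrank ℂ (LinearMap.range (B.comp Z).toLinearMap) := by
    rw [LinearMap.finrank_range_of_inj hBZinj, hFU]
  have hlt : principalAngle U (LinearMap.range Z.toLinearMap) < Real.pi / 2 := by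
    refine (tan_principalAngle_le hU0 hd1 (t := 6) (by norm_num) ?_).1
    rintro _ ⟨c, rfl⟩
    change ‖Z c - U.starProjection (Z c)‖ ≤ 6 * ‖U.starProjection (Z c)‖
    have h1 := norm_sq_eq_starProjection_add U (Z c)
    rw [hU, hZn] at h1
    rw [hU]
    refine le_trans ?_ (hfst c)
    exact abs_le_of_sq_le_sq' (by nlinarith [sq_nonneg ‖P 0 (Z c)‖]) (norm_nonneg c) |>.2
  have hnn : 0 ≤ principalAngle U (LinearMap.range Z.toLinearMap) := Real.arccos_nonneg _
  have htan := fun c => norm_sub_starProjection_le_tan hU0 hd1 hlt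
    (w := Z c) (LinearMap.mem_range_self _ c)
  simp only [hU] at htan
  have hpos : 0 < principalAngle U (LinearMap.range Z.toLinearMap) := by
    -- A zero angle makes the range of `Z` equal to `U`, so `U ≤ S`; `thd_left_le_of_range_le` then
    -- contradicts `hA₃`.
    refine hnn.lt_of_ne' fun h0 => ?_
    rw [h0, Real.tan_zero] at htan
    have hle : LinearMap.range Z.toLinearMap ≤ U := by
      rintro _ ⟨c, rfl⟩
      have h1 := htan c
      rw [zero_mul] at h1
      have h2 : Z c = U.starProjection (Z c) := by
        rw [hU]; exact sub_eq_zero.1 (norm_le_zero_iff.1 h1)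
      change Z c ∈ U
      rw [h2]
      exact U.starProjection_apply_mem _
    have heq := Submodule.eq_of_le_of_finrank_eq hle hd1.symm
    obtain ⟨c, hc⟩ := hA₃
    refine absurd (hA.thd_left_le_of_range_le hP hS (fun x => ?_) c) (not_le.2 hc)
    have h1 : P 0 x ∈ U := hU x ▸ U.starProjection_apply_mem x
    rw [← heq] at h1
    obtain ⟨c, hc⟩ := h1
    exact hc ▸ hZS c
  have htpos : 0 < Real.tan (principalAngle U (LinearMap.range Z.toLinearMap)) :=
    Real.tan_pos_of_pos_of_lt_pi_div_two hpos hlt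
  set τ := Real.tan (principalAngle U (LinearMap.range Z.toLinearMap))
  have hthd : ∀ c, ‖P 2 (Z c)‖ ≤ τ * ‖c‖ := fun c => by
    have h1 : P 2 (Z c - P 0 (Z c)) = P 2 (Z c) := by
      rw [map_sub, hP.ortho 2 0 _ (by decide), sub_zero]
    calc ‖P 2 (Z c)‖ ≤ ‖Z c - P 0 (Z c)‖ := h1 ▸ hP.norm_proj_le 2 _
      _ ≤ τ * ‖P 0 (Z c)‖ := htan c
      _ ≤ τ * ‖c‖ := by gcongr; exact (hP.norm_proj_le 0 _).trans_eq (hZn c)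
  have hsnd' : ∀ c, ‖P 1 (Z c)‖ ≤ 24 * (2 * m + 1) * ε * τ * ‖P 0 (Z c)‖ := fun c => by
    refine (hsnd τ htpos.le hthd c).trans ?_
    have : 4 * ε * (2 * m + 1) * τ * ‖c‖ ≤ 4 * ε * (2 * m + 1) * τ * (6 * ‖P 0 (Z c)‖) := by
      gcongr
      exact hfst c
    linarith
  set κ := 24 * (2 * m + 1) * ε
  have hκ : 0 ≤ κ := by positivity
  have hρ : 0 ≤ s₃ / s₁ + (s₂ - s₃) / s₁ * κ :=
    add_nonneg (div_nonneg hs₃ hs₁.le) (mul_nonneg (div_nonneg (by linarith) hs₁.le) hκ)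
  have hfin := tan_principalAngle_le hU0 hd2
    (t := (s₃ / s₁ + (s₂ - s₃) / s₁ * κ) * τ) (mul_nonneg hρ htpos.le) (by
      rintro _ ⟨c, rfl⟩
      change ‖B (Z c) - U.starProjection (B (Z c))‖ ≤ _ * ‖U.starProjection (B (Z c))‖
      rw [hU, hcomm, ← map_sub]
      have h1 : ‖B (Z c - P 0 (Z c))‖ ≤
          s₃ * ‖Z c - P 0 (Z c)‖ + (s₂ - s₃) * ‖P 1 (Z c)‖ := by
        -- Splitting `B` on the second block as `s₃` plus a remainder of norm at most `s₂ - s₃` is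
        -- what produces the factor `s₂ - s₃`. The first bracket is an orthogonal sum, so Pythagoras
        -- bounds it by `s₃‖Z c - P 0 (Z c)‖` without loss.
        have e1 : B (Z c - P 0 (Z c)) =
            (P 1 ((s₃ : ℂ) • Z c) + P 2 (B (Z c))) + (B (P 1 (Z c)) - (s₃ : ℂ) • P 1 (Z c)) := by
          rw [hsub, map_add, map_smul, hcomm]
          abel
        rw [e1]
        refine (norm_add_le _ _).trans (add_le_add ?_ (hB₂ _))
        refine abs_le_of_sq_le_sq' ?_ (by positivity) |>.2
        rw [hP.norm_add_sq (by decide), hsub, mul_pow, hP.norm_add_sq (by decide), map_smul,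
          norm_smul, Complex.norm_real, Real.norm_of_nonneg hs₃, hcomm, mul_pow, mul_add]
        gcongr
        rw [← mul_pow]
        gcongr
        exact hB₃ _
      have h2 : ‖B (Z c - P 0 (Z c))‖ ≤ (s₃ + (s₂ - s₃) * κ) * τ * ‖P 0 (Z c)‖ := by
        have e1 := mul_le_mul_of_nonneg_left (htan c) hs₃
        have e2 := mul_le_mul_of_nonneg_left (hsnd' c) (sub_nonneg.2 hs₂)
        linarith
      refine h2.trans ?_
      have h3 : (s₃ / s₁ + (s₂ - s₃) / s₁ * κ) * τ * (s₁ * ‖P 0 (Z c)‖) ≤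
          (s₃ / s₁ + (s₂ - s₃) / s₁ * κ) * τ * ‖B (P 0 (Z c))‖ :=
        mul_le_mul_of_nonneg_left (hB₁ _) (mul_nonneg hρ htpos.le)
      refine le_trans (le_of_eq ?_) h3
      field_simp)
  exact ⟨hpos, hlt, hfin.1, (div_le_iff₀ htpos).2 hfin.2⟩

end RitzAngles

/-! ### Matrices as operators, and operators diagonal in the eigenbasis. -/

section MatrixOperators

variable {m n p : ℕ}

/-- The operator between Euclidean spaces given by a matrix. -/
noncomputable def opCLM (A : Matrix (Fin n) (Fin m) ℂ) :
    EuclideanSpace ℂ (Fin m) →L[ℂ] EuclideanSpace ℂ (Fin n) :=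
  (Matrix.toEuclideanLin (𝕜 := ℂ)).trans LinearMap.toContinuousLinearMap A

theorem norm_opCLM (A : Matrix (Fin n) (Fin m) ℂ) : ‖opCLM A‖ = ‖A‖ := rfl

theorem norm_opCLM_apply_le (A : Matrix (Fin n) (Fin m) ℂ) (x : EuclideanSpace ℂ (Fin m)) :
    ‖opCLM A x‖ ≤ ‖A‖ * ‖x‖ := (opCLM A).le_opNorm x

theorem ofLp_opCLM (A : Matrix (Fin n) (Fin m) ℂ) (x : EuclideanSpace ℂ (Fin m)) :
    WithLp.ofLp (opCLM A x) = A *ᵥ WithLp.ofLp x := rfl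

theorem opCLM_mul (A : Matrix (Fin n) (Fin m) ℂ) (B : Matrix (Fin m) (Fin p) ℂ)
    (x : EuclideanSpace ℂ (Fin p)) : opCLM (A * B) x = opCLM A (opCLM B x) := by
  apply WithLp.ofLp_injective
  simp only [ofLp_opCLM, Matrix.mulVec_mulVec]

theorem opCLM_add (A B : Matrix (Fin n) (Fin m) ℂ) (x : EuclideanSpace ℂ (Fin m)) :
    opCLM (A + B) x = opCLM A x + opCLM B x := by
  apply WithLp.ofLp_injective
  simp only [ofLp_opCLM, Matrix.add_mulVec, WithLp.ofLp_add]

theorem opCLM_smul (a : ℂ) (A : Matrix (Fin n) (Fin m) ℂ) (x : EuclideanSpace ℂ (Fin m)) :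
    opCLM (a • A) x = a • opCLM A x := by
  apply WithLp.ofLp_injective
  simp only [ofLp_opCLM, Matrix.smul_mulVec, WithLp.ofLp_smul]

theorem opCLM_one (x : EuclideanSpace ℂ (Fin m)) :
    opCLM (1 : Matrix (Fin m) (Fin m) ℂ) x = x := by
  apply WithLp.ofLp_injective
  simp only [ofLp_opCLM, Matrix.one_mulVec]

theorem inner_opCLM (A : Matrix (Fin n) (Fin m) ℂ) (x : EuclideanSpace ℂ (Fin m))
    (y : EuclideanSpace ℂ (Fin n)) : inner ℂ (opCLM A x) y = inner ℂ x (opCLM Aᴴ y) := by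
  simp only [EuclideanSpace.inner_eq_star_dotProduct, ofLp_opCLM]
  rw [Matrix.star_mulVec, dotProduct_comm, ← Matrix.dotProduct_mulVec, dotProduct_comm]

theorem norm_opCLM_of_isometry {A : Matrix (Fin n) (Fin m) ℂ} (hA : Aᴴ * A = 1)
    (x : EuclideanSpace ℂ (Fin m)) : ‖opCLM A x‖ = ‖x‖ := by
  rw [@norm_eq_sqrt_re_inner ℂ, @norm_eq_sqrt_re_inner ℂ, inner_opCLM, ← opCLM_mul, hA, opCLM_one]

theorem colSpan_eq_range (A : Matrix (Fin n) (Fin m) ℂ) :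
    colSpan A = LinearMap.range (opCLM A).toLinearMap := by
  have h : ∀ j, (WithLp.toLp 2 fun i => A i j) = opCLM A (EuclideanSpace.single j 1) := fun j => by
    apply WithLp.ofLp_injective
    rw [ofLp_opCLM]
    ext i
    simp
  apply le_antisymm
  · refine Submodule.span_le.2 ?_
    rintro _ ⟨j, rfl⟩
    exact ⟨_, (h j).symm⟩
  · rintro _ ⟨x, rfl⟩
    have e : opCLM A x = ∑ j, x j • WithLp.toLp 2 fun i => A i j := by
      apply WithLp.ofLp_injective
      rw [ofLp_opCLM]
      ext i
      simp [Matrix.mulVec, dotProduct, mul_comm]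
    change opCLM A x ∈ _
    rw [e]
    exact Submodule.sum_mem _ fun j _ => Submodule.smul_mem _ _ (Submodule.subset_span ⟨j, rfl⟩)

theorem mem_colSpan_iff {A : Matrix (Fin n) (Fin m) ℂ} {w : EuclideanSpace ℂ (Fin n)} :
    w ∈ colSpan A ↔ ∃ c, opCLM A c = w := by
  rw [colSpan_eq_range]; rfl

/-- The operator with eigenvectors the columns of `V` and eigenvalues `d`. -/
noncomputable def spectralOp (V : Matrix (Fin n) (Fin n) ℂ) (d : Fin n → ℝ) :
    EuclideanSpace ℂ (Fin n) →L[ℂ] EuclideanSpace ℂ (Fin n) :=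
  opCLM (V * Matrix.diagonal (fun i => (d i : ℂ)) * Vᴴ)

variable {V : Matrix (Fin n) (Fin n) ℂ}

theorem conjTranspose_mul_self_of_unitary (hV : V ∈ Matrix.unitaryGroup (Fin n) ℂ) :
    Vᴴ * V = 1 := Matrix.mem_unitaryGroup_iff'.1 hV

theorem mul_conjTranspose_self_of_unitary (hV : V ∈ Matrix.unitaryGroup (Fin n) ℂ) :
    V * Vᴴ = 1 := Matrix.mem_unitaryGroup_iff.1 hV

theorem spectralOp_apply (d : Fin n → ℝ) (x : EuclideanSpace ℂ (Fin n)) :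
    spectralOp V d x = opCLM V (opCLM (Matrix.diagonal fun i => (d i : ℂ)) (opCLM Vᴴ x)) := by
  rw [spectralOp, opCLM_mul, opCLM_mul]

theorem spectralOp_mul (hV : V ∈ Matrix.unitaryGroup (Fin n) ℂ) (d e : Fin n → ℝ)
    (x : EuclideanSpace ℂ (Fin n)) :
    spectralOp V d (spectralOp V e x) = spectralOp V (d * e) x := by
  simp only [spectralOp_apply]
  rw [← opCLM_mul Vᴴ V, conjTranspose_mul_self_of_unitary hV, opCLM_one,
    ← opCLM_mul (Matrix.diagonal _), Matrix.diagonal_mul_diagonal]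
  simp

theorem spectralOp_add (d e : Fin n → ℝ) (x : EuclideanSpace ℂ (Fin n)) :
    spectralOp V (d + e) x = spectralOp V d x + spectralOp V e x := by
  simp only [spectralOp_apply]
  rw [← map_add, ← opCLM_add, Matrix.diagonal_add]
  simp

theorem spectralOp_smul (a : ℝ) (d : Fin n → ℝ) (x : EuclideanSpace ℂ (Fin n)) :
    spectralOp V (a • d) x = (a : ℂ) • spectralOp V d x := by
  simp only [spectralOp_apply]
  rw [← map_smul, ← opCLM_smul, ← Matrix.diagonal_smul]
  congr 3
  ext
  simp [Matrix.diagonal_apply]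

theorem spectralOp_one (hV : V ∈ Matrix.unitaryGroup (Fin n) ℂ) (x : EuclideanSpace ℂ (Fin n)) :
    spectralOp V 1 x = x := by
  have h : Matrix.diagonal (fun i => (((1 : Fin n → ℝ) i : ℝ) : ℂ)) = 1 := by simp
  rw [spectralOp_apply, h, opCLM_one, ← opCLM_mul, mul_conjTranspose_self_of_unitary hV, opCLM_one]

theorem inner_spectralOp (d : Fin n → ℝ) (x y : EuclideanSpace ℂ (Fin n)) :
    inner ℂ (spectralOp V d x) y = inner ℂ x (spectralOp V d y) := by
  rw [spectralOp, inner_opCLM]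
  congr 3
  have h : star (fun i => (d i : ℂ)) = fun i => (d i : ℂ) := by ext; simp
  rw [Matrix.conjTranspose_mul, Matrix.conjTranspose_mul, Matrix.diagonal_conjTranspose,
    Matrix.conjTranspose_conjTranspose, h, Matrix.mul_assoc]

theorem norm_spectralOp_le (hV : V ∈ Matrix.unitaryGroup (Fin n) ℂ) {d : Fin n → ℝ} {r : ℝ}
    (hr : 0 ≤ r) (hd : ∀ i, |d i| ≤ r) (x : EuclideanSpace ℂ (Fin n)) :
    ‖spectralOp V d x‖ ≤ r * ‖x‖ := by
  rw [spectralOp_apply, norm_opCLM_of_isometry (conjTranspose_mul_self_of_unitary hV)]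
  refine (norm_opCLM_apply_le _ _).trans ?_
  rw [norm_opCLM_of_isometry (A := Vᴴ) (by
    rw [Matrix.conjTranspose_conjTranspose, mul_conjTranspose_self_of_unitary hV]),
    Matrix.l2_opNorm_diagonal]
  gcongr
  refine (pi_norm_le_iff_of_nonneg hr).2 fun i => ?_
  rw [Complex.norm_real]
  exact hd i

theorem submatrix_isometry {A : Matrix (Fin n) (Fin m) ℂ} (hA : Aᴴ * A = 1) {f : Fin p → Fin m}
    (hf : Function.Injective f) : (A.submatrix id f)ᴴ * A.submatrix id f = 1 := by
  rw [Matrix.conjTranspose_submatrix,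
    ← Matrix.submatrix_mul _ _ _ _ _ Function.bijective_id, hA, Matrix.submatrix_one f hf]

theorem mul_diagonal_submatrix (A : Matrix (Fin n) (Fin m) ℂ) (d : Fin m → ℂ) (f : Fin p → Fin m) :
    (A * Matrix.diagonal d).submatrix id f =
      A.submatrix id f * Matrix.diagonal (fun i => d (f i)) := by
  ext i j
  simp [Matrix.mul_diagonal]

theorem submatrix_mul_conjTranspose {f : Fin p → Fin n} (hf : Function.Injective f)
    {d : Fin n → ℝ} (h1 : ∀ j, d (f j) = 1) (h0 : ∀ i, i ∉ Set.range f → d i = 0) :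
    V * Matrix.diagonal (fun i => (d i : ℂ)) * Vᴴ =
      V.submatrix id f * (V.submatrix id f)ᴴ := by
  ext a b
  rw [Matrix.mul_apply, Matrix.mul_apply]
  refine (Fintype.sum_of_injective f hf _ _ ?_ ?_).symm
  · intro i hi
    rw [Matrix.mul_diagonal, h0 i hi]
    simp
  · intro j
    rw [Matrix.mul_diagonal, h1 j]
    simp

theorem norm_spectralOp_eq (hV : V ∈ Matrix.unitaryGroup (Fin n) ℂ)
    {f : Fin p → Fin n} (hf : Function.Injective f)
    {d : Fin n → ℝ} (h1 : ∀ j, d (f j) = 1) (h0 : ∀ i, i ∉ Set.range f → d i = 0)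
    (x : EuclideanSpace ℂ (Fin n)) :
    ‖spectralOp V d x‖ = ‖opCLM (V.submatrix id f)ᴴ x‖ := by
  rw [spectralOp, submatrix_mul_conjTranspose hf h1 h0, opCLM_mul, norm_opCLM_of_isometry
    (submatrix_isometry (conjTranspose_mul_self_of_unitary hV) hf)]

theorem spectralOp_submatrix (hV : V ∈ Matrix.unitaryGroup (Fin n) ℂ) (f : Fin p → Fin n)
    {d : Fin n → ℝ} {r : ℝ} (h : ∀ j, d (f j) = r) (x : EuclideanSpace ℂ (Fin p)) :
    spectralOp V d (opCLM (V.submatrix id f) x) = (r : ℂ) • opCLM (V.submatrix id f) x := by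
  rw [spectralOp, ← opCLM_mul, ← opCLM_smul]
  congr 2
  have e : V * Matrix.diagonal (fun i => (d i : ℂ)) * Vᴴ * V.submatrix id f =
      (V * Matrix.diagonal (fun i => (d i : ℂ)) * Vᴴ * V).submatrix id f := by
    rw [Matrix.submatrix_mul _ _ id id f Function.bijective_id, Matrix.submatrix_id_id]
  rw [e, Matrix.mul_assoc, conjTranspose_mul_self_of_unitary hV, Matrix.mul_one,
    mul_diagonal_submatrix]
  ext i j
  simp [Matrix.mul_diagonal, h, mul_comm]

end MatrixOperators

/-! ### Spectral projections of the three eigenvector blocks. -/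

section Blocks

variable {n : ℕ} {V : Matrix (Fin n) (Fin n) ℂ}

/-- The indicator function of the `s`-th of the three blocks of indices, of sizes `k`, `l - k`,
`n - l`. -/
def blockIndicator (n k l : ℕ) (s : Fin 3) (i : Fin n) : ℝ :=
  if (if i.1 < k then 0 else if i.1 < l then 1 else 2 : Fin 3) = s then 1 else 0

/-- The spectral projections onto the three blocks of eigenvectors. -/
noncomputable def blockProj (V : Matrix (Fin n) (Fin n) ℂ) (k l : ℕ) (s : Fin 3) :
    EuclideanSpace ℂ (Fin n) →L[ℂ] EuclideanSpace ℂ (Fin n) :=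
  spectralOp V (blockIndicator n k l s)

theorem isOrthogonalResolution_blockProj (hV : V ∈ Matrix.unitaryGroup (Fin n) ℂ) (k l : ℕ) :
    IsOrthogonalResolution (blockProj V k l) where
  add x := by
    simp only [blockProj]
    rw [← spectralOp_add, ← spectralOp_add]
    conv_rhs => rw [← spectralOp_one hV x]
    congr 2
    ext i
    simp only [Pi.add_apply, blockIndicator, Pi.one_apply]
    split_ifs <;> simp_all
  symm i x y := inner_spectralOp _ x y
  idem i x := by
    simp only [blockProj]
    rw [spectralOp_mul hV]
    congr 2
    ext i
    simp [blockIndicator]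
  ortho s t x hst := by
    simp only [blockProj]
    rw [spectralOp_mul hV]
    have h : blockIndicator n k l s * blockIndicator n k l t = (0 : ℝ) • 1 := by
      ext i
      simp only [Pi.mul_apply, blockIndicator, zero_smul, Pi.zero_apply]
      split_ifs <;> simp_all
    rw [h, spectralOp_smul, Complex.ofReal_zero, zero_smul]

theorem spectralOp_blockProj_comm (hV : V ∈ Matrix.unitaryGroup (Fin n) ℂ) (k l : ℕ) (s : Fin 3)
    (d : Fin n → ℝ) (x : EuclideanSpace ℂ (Fin n)) :
    blockProj V k l s (spectralOp V d x) = spectralOp V d (blockProj V k l s x) := by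
  rw [blockProj, spectralOp_mul hV, spectralOp_mul hV, mul_comm]

/-- Idempotency lets `d` be multiplied by the block indicator, so eigenvalues outside the block do
not matter. -/
theorem norm_spectralOp_blockProj_le (hV : V ∈ Matrix.unitaryGroup (Fin n) ℂ) {k l : ℕ} {s : Fin 3}
    {d : Fin n → ℝ} {r : ℝ} (hr : 0 ≤ r) (hd : ∀ i, blockIndicator n k l s i ≠ 0 → |d i| ≤ r)
    (x : EuclideanSpace ℂ (Fin n)) :
    ‖spectralOp V d (blockProj V k l s x)‖ ≤ r * ‖blockProj V k l s x‖ := by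
  have h := (isOrthogonalResolution_blockProj hV k l).idem s x
  rw [← h, blockProj, spectralOp_mul hV, ← blockProj, h]
  refine norm_spectralOp_le hV hr (fun i => ?_) _
  rw [Pi.mul_apply, abs_mul]
  by_cases hi : blockIndicator n k l s i = 0
  · rw [hi, abs_zero, mul_zero]; exact hr
  · refine (mul_le_of_le_one_right (abs_nonneg _) ?_).trans (hd i hi)
    unfold blockIndicator
    split_ifs <;> simp

end Blocks

/-! ### The matrix data satisfy the abstract hypotheses. -/

section Assembly

variable {n k l : ℕ} {V : Matrix (Fin n) (Fin n) ℂ}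

/-- The embedding of the second block of indices. -/
def midEmb (hln : l < n) (j : Fin (l - k)) : Fin n := ⟨k + j.1, by omega⟩

/-- The embedding of the third block of indices. -/
def tailEmb (n l : ℕ) (j : Fin (n - l)) : Fin n := ⟨l + j.1, by omega⟩

theorem norm_blockProj_zero (hV : V ∈ Matrix.unitaryGroup (Fin n) ℂ) (hkn : k ≤ n)
    (x : EuclideanSpace ℂ (Fin n)) :
    ‖blockProj V k l 0 x‖ = ‖opCLM (V.submatrix id (Fin.castLE hkn))ᴴ x‖ := by
  refine norm_spectralOp_eq hV (Fin.castLE_injective hkn) (fun j => ?_) (fun i hi => ?_) x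
  · simp [blockIndicator]
  · have : ¬ i.1 < k := fun h => hi ⟨⟨i.1, h⟩, rfl⟩
    simp only [blockIndicator, this, if_false]
    split_ifs <;> simp_all

theorem norm_blockProj_two (hV : V ∈ Matrix.unitaryGroup (Fin n) ℂ) (hkl : k < l)
    (x : EuclideanSpace ℂ (Fin n)) :
    ‖blockProj V k l 2 x‖ = ‖opCLM (V.submatrix id (tailEmb n l))ᴴ x‖ := by
  refine norm_spectralOp_eq hV (fun i j h => ?_) (fun j => ?_) (fun i hi => ?_) x
  · simpa [tailEmb, Fin.ext_iff] using h
  · have h1 : ¬ l + j.1 < k := by omega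
    simp [blockIndicator, tailEmb, h1]
  · have : i.1 < l := by
      by_contra h
      exact hi ⟨⟨i.1 - l, by omega⟩, Fin.ext (by simp only [tailEmb]; omega)⟩
    simp only [blockIndicator, this, if_true]
    split_ifs <;> simp_all

theorem leadRows_eq {m : ℕ} (hkn : k ≤ n) (X : Matrix (Fin n) (Fin m) ℂ) :
    leadRows hkn (Vᴴ * X) = (V.submatrix id (Fin.castLE hkn))ᴴ * X := rfl

theorem tailRows_eq {m : ℕ} (X : Matrix (Fin n) (Fin m) ℂ) :
    tailRows l (Vᴴ * X) = (V.submatrix id (tailEmb n l))ᴴ * X := rfl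

theorem mul_midUnit (hln : l < n) : V * midUnit n k l = V.submatrix id (midEmb (k := k) hln) := by
  ext i j
  rw [Matrix.mul_apply, Finset.sum_eq_single (midEmb hln j)]
  · simp [midUnit, midEmb]
  · intro b _ hb
    have : b.1 ≠ k + j.1 := fun h => hb (Fin.ext h)
    simp [midUnit, this]
  · simp

theorem norm_blockProj_zero_mul_inv (hV : V ∈ Matrix.unitaryGroup (Fin n) ℂ)
    (hkn : k ≤ n) {X : Matrix (Fin n) (Fin k) ℂ} (hX : IsUnit (leadRows hkn (Vᴴ * X)).det)
    (c : EuclideanSpace ℂ (Fin k)) :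
    ‖blockProj V k l 0 (opCLM (X * (leadRows hkn (Vᴴ * X))⁻¹) c)‖ = ‖c‖ := by
  rw [norm_blockProj_zero hV hkn, ← opCLM_mul, ← Matrix.mul_assoc, ← leadRows_eq,
    Matrix.mul_nonsing_inv _ hX, opCLM_one]

theorem norm_blockProj_two_mul (hV : V ∈ Matrix.unitaryGroup (Fin n) ℂ) (hkl : k < l)
    (X : Matrix (Fin n) (Fin k) ℂ) (Q : Matrix (Fin k) (Fin k) ℂ)
    (c : EuclideanSpace ℂ (Fin k)) :
    ‖blockProj V k l 2 (opCLM (X * Q) c)‖ = ‖opCLM (tailRows l (Vᴴ * X) * Q) c‖ := by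
  rw [norm_blockProj_two hV hkl, ← opCLM_mul, ← Matrix.mul_assoc, ← tailRows_eq]

theorem isExpansion_opCLM (hV : V ∈ Matrix.unitaryGroup (Fin n) ℂ) (hkl : k < l) (hln : l < n)
    {X : Matrix (Fin n) (Fin k) ℂ} {Δ : Matrix (Fin n) (Fin (l - k)) ℂ} {M ε : ℝ}
    (hX : IsUnit (leadRows (hkl.trans hln).le (Vᴴ * X)).det) (hM : 1 ≤ M)
    (hε : 0 ≤ ε) (hεM : 4 * (ε * M) ≤ 1) (hΔ : ‖Δ‖ ≤ 1)
    (hη : ‖tailRows l (Vᴴ * X) * (leadRows (hkl.trans hln).le (Vᴴ * X))⁻¹‖ ≤ 1)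
    (hXM : ‖X * (leadRows (hkl.trans hln).le (Vᴴ * X))⁻¹‖ ≤ M) :
    IsExpansion (blockProj V k l) (opCLM (X * (leadRows (hkl.trans hln).le (Vᴴ * X))⁻¹))
      (opCLM (V * (midUnit n k l + (ε : ℂ) • Δ))) M ε := by
  have hP := isOrthogonalResolution_blockProj hV k l
  set f : Fin (l - k) → Fin n := midEmb hln
  have hf : Function.Injective f := fun i j h => by simpa [f, midEmb, Fin.ext_iff] using h
  have hD : ∀ y, opCLM (V * (midUnit n k l + (ε : ℂ) • Δ)) y =
      opCLM (V.submatrix id f) y + (ε : ℂ) • opCLM V (opCLM Δ y) := fun y => by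
    rw [Matrix.mul_add, opCLM_add, mul_midUnit hln, Matrix.mul_smul, opCLM_smul, opCLM_mul V Δ]
  have hpert : ∀ y, ‖(ε : ℂ) • opCLM V (opCLM Δ y)‖ ≤ ε * ‖y‖ := fun y => by
    rw [norm_smul, Complex.norm_real, Real.norm_of_nonneg hε,
      norm_opCLM_of_isometry (conjTranspose_mul_self_of_unitary hV)]
    gcongr
    exact (norm_opCLM_apply_le _ _).trans (mul_le_of_le_one_left (norm_nonneg _) hΔ)
  have hblock : ∀ (s : Fin 3) (y), blockProj V k l s (opCLM (V.submatrix id f) y) =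
      ((if s = 1 then 1 else 0 : ℝ) : ℂ) • opCLM (V.submatrix id f) y := fun s y => by
    refine spectralOp_submatrix hV f (fun j => ?_) y
    have h1 : ¬ k + j.1 < k := by omega
    have h2 : k + j.1 < l := by omega
    simp only [blockIndicator, f, midEmb, h1, h2, if_false, if_true, eq_comm]
  exact {
    one_le := hM
    eps_nonneg := hε
    eps_mul_le := hεM
    fst_left := norm_blockProj_zero_mul_inv hV _ hX
    norm_left := fun c => (norm_opCLM_apply_le _ c).trans
      (mul_le_mul_of_nonneg_right hXM (norm_nonneg c))
    thd_left := fun c => by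
      rw [norm_blockProj_two_mul hV hkl]
      exact (norm_opCLM_apply_le _ c).trans (mul_le_of_le_one_left (norm_nonneg _) hη)
    fst_right := fun y => by
      rw [hD, map_add, hblock, if_neg (by decide), Complex.ofReal_zero, zero_smul, zero_add]
      exact (hP.norm_proj_le 0 _).trans (hpert y)
    snd_right := fun y => by
      have h1 : opCLM (V.submatrix id f) y = blockProj V k l 1
          (opCLM (V * (midUnit n k l + (ε : ℂ) • Δ)) y) -
          blockProj V k l 1 ((ε : ℂ) • opCLM V (opCLM Δ y)) := by
        rw [hD, map_add, add_sub_cancel_right, hblock, if_pos rfl, Complex.ofReal_one, one_smul]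
      calc ‖y‖ = ‖opCLM (V.submatrix id f) y‖ := (norm_opCLM_of_isometry
            (submatrix_isometry (conjTranspose_mul_self_of_unitary hV) hf) y).symm
        _ ≤ _ := by
          rw [h1]
          exact (norm_sub_le _ _).trans
            (add_le_add_right ((hP.norm_proj_le 1 _).trans (hpert y)) _)
    thd_right := fun y => by
      rw [hD, map_add, hblock, if_neg (by decide), Complex.ofReal_zero, zero_smul, zero_add]
      exact (hP.norm_proj_le 2 _).trans (hpert y) }

/-- The lower bound is the upper bound for the inverse operator, with eigenvalues `σ⁻¹`. -/
theorem le_norm_spectralOp_blockProj_zero (hV : V ∈ Matrix.unitaryGroup (Fin n) ℂ) {σ : Fin n → ℝ}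
    (hσ0 : ∀ i, 0 < σ i) {s : ℝ} (hs : 0 < s) (hσ : ∀ i : Fin n, i.1 < k → s ≤ σ i)
    (x : EuclideanSpace ℂ (Fin n)) :
    s * ‖blockProj V k l 0 x‖ ≤ ‖spectralOp V σ (blockProj V k l 0 x)‖ := by
  have h1 := norm_spectralOp_blockProj_le hV (k := k) (l := l) (s := 0)
    (d := σ⁻¹) (r := s⁻¹) (inv_nonneg.2 hs.le) (fun i hi => by
      have hik : i.1 < k := by
        by_contra h
        refine hi ?_
        simp only [blockIndicator, h, if_false]
        split_ifs <;> simp_all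
      rw [Pi.inv_apply, abs_of_pos (inv_pos.2 (hσ0 i))]
      exact inv_anti₀ hs (hσ i hik)) (spectralOp V σ x)
  have e : σ⁻¹ * σ = 1 := by
    ext i
    exact inv_mul_cancel₀ (hσ0 i).ne'
  rwa [spectralOp_blockProj_comm hV, spectralOp_mul hV, e, spectralOp_one hV, inv_mul_eq_div,
    le_div_iff₀ hs, mul_comm] at h1

theorem norm_spectralOp_sub_blockProj_one_le (hV : V ∈ Matrix.unitaryGroup (Fin n) ℂ)
    {σ : Fin n → ℝ} {s t : ℝ} (hst : s ≤ t)
    (hσ : ∀ i : Fin n, k ≤ i.1 → i.1 < l → s ≤ σ i ∧ σ i ≤ t) (x : EuclideanSpace ℂ (Fin n)) :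
    ‖spectralOp V σ (blockProj V k l 1 x) - (s : ℂ) • blockProj V k l 1 x‖ ≤
      (t - s) * ‖blockProj V k l 1 x‖ := by
  have h1 := norm_spectralOp_blockProj_le hV (k := k) (l := l) (s := 1)
    (d := σ + (-s) • 1) (r := t - s) (sub_nonneg.2 hst) (fun i hi => by
      have hik : k ≤ i.1 ∧ i.1 < l := by
        by_contra h
        refine hi ?_
        simp only [blockIndicator]
        split_ifs <;> first | omega | simp_all
      obtain ⟨e1, e2⟩ := hσ i hik.1 hik.2
      simp only [Pi.add_apply, Pi.smul_apply, Pi.one_apply, smul_eq_mul, mul_one]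
      rw [abs_of_nonneg (by linarith)]
      linarith) x
  rwa [spectralOp_add, spectralOp_smul, spectralOp_one hV, Complex.ofReal_neg, neg_smul,
    ← sub_eq_add_neg] at h1

theorem norm_spectralOp_blockProj_two_le (hV : V ∈ Matrix.unitaryGroup (Fin n) ℂ) {σ : Fin n → ℝ}
    {s : ℝ} (hs : 0 ≤ s) (hσ : ∀ i : Fin n, l ≤ i.1 → |σ i| ≤ s)
    (x : EuclideanSpace ℂ (Fin n)) :
    ‖spectralOp V σ (blockProj V k l 2 x)‖ ≤ s * ‖blockProj V k l 2 x‖ := by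
  refine norm_spectralOp_blockProj_le hV hs (fun i hi => hσ i ?_) x
  by_contra h
  refine hi ?_
  simp only [blockIndicator]
  split_ifs <;> first | omega | simp_all

/-- Passing from `X` to `X X_k⁻¹` normalises the leading block without changing the search space. -/
theorem mem_colSpan_sup_iff {m : ℕ} {X : Matrix (Fin n) (Fin k) ℂ} {Y : Matrix (Fin n) (Fin m) ℂ}
    {Q : Matrix (Fin k) (Fin k) ℂ} (hQ : IsUnit Q.det) (w : EuclideanSpace ℂ (Fin n)) :
    w ∈ colSpan X ⊔ colSpan Y ↔ ∃ c y, w = opCLM (X * Q⁻¹) c + opCLM Y y := by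
  rw [Submodule.mem_sup]
  constructor
  · rintro ⟨_, hx, _, hy, rfl⟩
    obtain ⟨c, rfl⟩ := mem_colSpan_iff.1 hx
    obtain ⟨y, rfl⟩ := mem_colSpan_iff.1 hy
    refine ⟨opCLM Q c, y, ?_⟩
    rw [← opCLM_mul, Matrix.mul_assoc, Matrix.nonsing_inv_mul _ hQ, Matrix.mul_one]
  · rintro ⟨c, y, rfl⟩
    refine ⟨_, mem_colSpan_iff.2 ⟨opCLM Q⁻¹ c, rfl⟩, _, mem_colSpan_iff.2 ⟨y, rfl⟩, ?_⟩
    rw [opCLM_mul]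

theorem starProjection_colSpan_leadCols (hV : V ∈ Matrix.unitaryGroup (Fin n) ℂ) (hkn : k ≤ n)
    (x : EuclideanSpace ℂ (Fin n)) :
    (colSpan (leadCols hkn V)).starProjection x = blockProj V k l 0 x := by
  have hP := isOrthogonalResolution_blockProj hV k l
  have h1 : ∀ j, blockIndicator n k l 0 (Fin.castLE hkn j) = 1 := fun j => by
    simp [blockIndicator]
  refine Submodule.eq_starProjection_of_mem_of_inner_eq_zero ?_ ?_
  · rw [mem_colSpan_iff]
    refine ⟨opCLM (V.submatrix id (Fin.castLE hkn))ᴴ x, ?_⟩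
    rw [blockProj, spectralOp, submatrix_mul_conjTranspose (Fin.castLE_injective hkn) h1
      (fun i hi => ?_), opCLM_mul]
    · rfl
    · have : ¬ i.1 < k := fun h => hi ⟨⟨i.1, h⟩, rfl⟩
      simp only [blockIndicator, this, if_false]
      split_ifs <;> simp_all
  · intro w hw
    obtain ⟨c, rfl⟩ := mem_colSpan_iff.1 hw
    have h2 : blockProj V k l 0 (opCLM (leadCols hkn V) c) = opCLM (leadCols hkn V) c := by
      have := spectralOp_submatrix hV (Fin.castLE hkn) h1 c
      rwa [Complex.ofReal_one, one_smul] at this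
    rw [← h2, ← hP.symm, map_sub, hP.idem, sub_self, inner_zero_left]

theorem finrank_colSpan_of_isometry {m : ℕ} {A : Matrix (Fin n) (Fin m) ℂ} (hA : Aᴴ * A = 1) :
    Module.finrank ℂ (colSpan A) = m := by
  rw [colSpan_eq_range, LinearMap.finrank_range_of_inj, finrank_euclideanSpace_fin]
  rw [injective_iff_map_eq_zero]
  intro c hc
  have h : ‖opCLM A c‖ = 0 := by rw [show opCLM A c = 0 from hc, norm_zero]
  exact norm_eq_zero.1 ((norm_opCLM_of_isometry hA c).symm.trans h)

theorem finrank_range_blockProj_le (hkl : k < l) (hln : l ≤ n) :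
    Module.finrank ℂ (LinearMap.range (blockProj V k l 0 + blockProj V k l 1).toLinearMap) ≤ l := by
  have h : LinearMap.range (blockProj V k l 0 + blockProj V k l 1).toLinearMap ≤
      LinearMap.range (opCLM (V.submatrix id (Fin.castLE hln))).toLinearMap := by
    rintro _ ⟨x, rfl⟩
    refine ⟨opCLM (V.submatrix id (Fin.castLE hln))ᴴ x, ?_⟩
    change opCLM _ (opCLM _ x) = blockProj V k l 0 x + blockProj V k l 1 x
    rw [blockProj, blockProj, ← spectralOp_add, spectralOp,
      submatrix_mul_conjTranspose (Fin.castLE_injective hln) (fun j => ?_) (fun i hi => ?_),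
      opCLM_mul]
    · by_cases hj : j.1 < k <;> simp [blockIndicator, hj]
    · have h1 : ¬ i.1 < l := fun h => hi ⟨⟨i.1, h⟩, rfl⟩
      have h2 : ¬ i.1 < k := by omega
      simp [blockIndicator, h1, h2]
  refine (Submodule.finrank_mono h).trans ((LinearMap.finrank_range_le _).trans ?_)
  rw [finrank_euclideanSpace_fin]

namespace IsRayleighRitz

variable {m : ℕ} {B : Matrix (Fin n) (Fin n) ℂ} {S : Submodule ℂ (EuclideanSpace ℂ (Fin n))}
  {θ : Fin m → ℝ} {Z : Matrix (Fin n) (Fin m) ℂ}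

theorem conjTranspose_mul_self (h : IsRayleighRitz B S θ Z) : Zᴴ * Z = 1 := by
  obtain ⟨Y, C, hY, -, hC, -, -, rfl⟩ := h
  rw [Matrix.conjTranspose_mul, Matrix.mul_assoc, ← Matrix.mul_assoc Yᴴ, hY, Matrix.one_mul,
    conjTranspose_mul_self_of_unitary hC]

theorem opCLM_mem (h : IsRayleighRitz B S θ Z) {p : ℕ} (f : Fin p → Fin m)
    (c : EuclideanSpace ℂ (Fin p)) : opCLM (Z.submatrix id f) c ∈ S := by
  obtain ⟨Y, C, -, rfl, -, -, -, rfl⟩ := h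
  rw [mem_colSpan_iff]
  refine ⟨opCLM (C.submatrix id f) c, ?_⟩
  rw [← opCLM_mul, Matrix.submatrix_mul _ _ id id f Function.bijective_id, Matrix.submatrix_id_id]

/-- The Galerkin condition of the Rayleigh--Ritz process, in inverse form. -/
theorem exists_inner_eq_zero (h : IsRayleighRitz B S θ Z) {p : ℕ} (f : Fin p → Fin m) {q : ℝ}
    (hq : 0 < q) (hθ : ∀ j, q ≤ θ (f j)) (c : EuclideanSpace ℂ (Fin p)) :
    ∃ c', q * ‖c'‖ ≤ ‖c‖ ∧ ∀ y ∈ S, inner ℂ y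
      (opCLM B (opCLM (Z.submatrix id f) c') - opCLM (Z.submatrix id f) c) = 0 := by
  obtain ⟨Y, C, hY, rfl, hC, -, hspec, rfl⟩ := h
  set Zf := (Y * C).submatrix id f
  set Θ : Matrix (Fin p) (Fin p) ℂ := Matrix.diagonal fun j => (θ (f j) : ℂ)
  have hpos : ∀ j, 0 < θ (f j) := fun j => hq.trans_le (hθ j)
  -- The witness is `Θ⁻¹ c`: the Galerkin equation `Yᴴ B Z = Yᴴ Z Θ` applied to it returns `Yᴴ Z c`,
  -- and `‖Θ⁻¹‖ ≤ q⁻¹`.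
  refine ⟨opCLM (Matrix.diagonal fun j => ((θ (f j))⁻¹ : ℂ)) c, ?_, ?_⟩
  · rw [← le_div_iff₀' hq, div_eq_inv_mul]
    refine (norm_opCLM_apply_le _ c).trans ?_
    gcongr
    rw [Matrix.l2_opNorm_diagonal]
    refine (pi_norm_le_iff_of_nonneg (inv_nonneg.2 hq.le)).2 fun j => ?_
    rw [norm_inv, Complex.norm_real, Real.norm_of_nonneg (hpos j).le]
    exact inv_anti₀ hq (hθ j)
  · intro y hy
    obtain ⟨d, rfl⟩ := mem_colSpan_iff.1 hy
    set c' := opCLM (Matrix.diagonal fun j => ((θ (f j))⁻¹ : ℂ)) c with hc'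
    have hc : c = opCLM Θ c' := by
      rw [hc', ← opCLM_mul, Matrix.diagonal_mul_diagonal]
      have e : (fun j => (θ (f j) : ℂ) * (θ (f j) : ℂ)⁻¹) = fun _ => 1 := by
        ext j
        exact mul_inv_cancel₀ (Complex.ofReal_ne_zero.2 (hpos j).ne')
      rw [e, Matrix.diagonal_one, opCLM_one]
    have hgal : Yᴴ * (B * (Y * C)) = Yᴴ * (Y * C * Matrix.diagonal fun i => (θ i : ℂ)) := by
      have e1 : Yᴴ * (B * (Y * C)) = (Yᴴ * B * Y) * C := by simp only [Matrix.mul_assoc]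
      rw [e1, hspec, Matrix.mul_assoc _ Cᴴ C, conjTranspose_mul_self_of_unitary hC, Matrix.mul_one,
        Matrix.mul_assoc Y, ← Matrix.mul_assoc Yᴴ Y, hY, Matrix.one_mul]
    have hgal' : Yᴴ * (B * Zf) = Yᴴ * (Zf * Θ) := by
      have e : Yᴴ * (B * Zf) = Yᴴ * (Y * C * Matrix.diagonal fun i => (θ i : ℂ)).submatrix id f :=
        congrArg (fun A => A.submatrix id f) hgal
      rw [e, mul_diagonal_submatrix]
    rw [inner_opCLM, hc, map_sub]
    simp only [← opCLM_mul]
    rw [hgal', sub_self, inner_zero_right]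

end IsRayleighRitz

end Assembly

end ShrinkExpand

/-! ### Choice of constants and conclusion. -/

theorem mainTheorem1 (Mη Mα : ℝ) :
    ∃ c : ℝ, 0 < c ∧ ∃ K : ℝ, 0 < K ∧
      ∀ (n k l : ℕ) (hk : 1 ≤ k) (hkl : k < l) (hln : l < n)
        (B V : Matrix (Fin n) (Fin n) ℂ) (σ : Fin n → ℝ)
        (X : Matrix (Fin n) (Fin k) ℂ) (Xexp Δ : Matrix (Fin n) (Fin (l - k)) ℂ)
        (ε ηt ηh : ℝ),
        -- eigenpairs of the Hermitian positive definite matrix `B`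
        B.PosDef → V ∈ Matrix.unitaryGroup (Fin n) ℂ →
        B * V = V * Matrix.diagonal (fun i => (σ i : ℂ)) → Antitone σ → (∀ i, 0 < σ i) →
        -- the orthonormal matrix `X`, with nonsingular leading coefficient block
        Xᴴ * X = 1 → IsUnit (ShrinkExpand.leadRows (hkl.trans hln).le (Vᴴ * X)).det →
        -- the expansion block
        0 ≤ ε → ‖Δ‖ = 1 → Xexp = V * (ShrinkExpand.midUnit n k l + (ε : ℂ) • Δ) →
        -- the quantities `η̃` and `η̂`
        ηt = ‖ShrinkExpand.tailRows l (Vᴴ * X) *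
          (ShrinkExpand.leadRows (hkl.trans hln).le (Vᴴ * X))⁻¹‖ →
        ηh = ‖X * (ShrinkExpand.leadRows (hkl.trans hln).le (Vᴴ * X))⁻¹‖ →
        -- smallness assumptions
        0 < ηt → ηt < 1 → ηh ≤ Mη → ε ≤ c * ηt → ε ≤ c * ((1 - ηt ^ 2) / 2) →
        Module.finrank ℂ ↥(ShrinkExpand.colSpan X ⊔ ShrinkExpand.colSpan Xexp) = l ∧
        ∀ (θ : Fin l → ℝ) (Z : Matrix (Fin n) (Fin l) ℂ) (α : ℝ),
          ShrinkExpand.IsRayleighRitz B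
            (ShrinkExpand.colSpan X ⊔ ShrinkExpand.colSpan Xexp) θ Z →
          -- the spectral gap `α`
          0 < α →
          (∀ (i : Fin l) (j : Fin n), i.1 < k → k ≤ j.1 → j.1 < l → σ j + α < θ i) →
          σ ⟨0, by omega⟩ / α ≤ Mα →
          ∀ (Xnew : Matrix (Fin n) (Fin k) ℂ), Xnew = ShrinkExpand.leadCols hkl.le Z →
          ∀ (Vk : Matrix (Fin n) (Fin k) ℂ),
            Vk = ShrinkExpand.leadCols (hkl.trans hln).le V →
          ∀ (φ ψ : ℝ),
            φ = ShrinkExpand.principalAngle (ShrinkExpand.colSpan Vk)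
              (ShrinkExpand.colSpan Xnew) →
            ψ = ShrinkExpand.principalAngle (ShrinkExpand.colSpan Vk)
              (ShrinkExpand.colSpan (B * Xnew)) →
            0 < φ ∧ φ < Real.pi / 2 ∧ ψ < Real.pi / 2 ∧
            Real.tan ψ / Real.tan φ ≤
              σ ⟨l, hln⟩ / σ ⟨k - 1, by omega⟩ +
                (σ ⟨k, by omega⟩ - σ ⟨l, hln⟩) / σ ⟨k - 1, by omega⟩ * (K * ε) := by

  set M : ℝ := max Mη 1
  set m : ℝ := max Mα 1
  have hM1 : 1 ≤ M := le_max_right _ _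
  have hm1 : 1 ≤ m := le_max_right _ _
  have hM0 : 0 < M := by linarith
  have hm0 : 0 < m := by linarith
  -- The first constant ensures both `8εM ≤ η̃` and `4(2m + 1)ε ≤ 1/4`. In the second, `24` is `4`
  -- from the test vectors times `6` from the a priori bound.
  refine ⟨1 / (32 * (2 * m + 1) * M), by positivity, 24 * (2 * m + 1), by positivity, ?_⟩
  intro n k l hk hkl hln B V σ X Xexp Δ ε ηt ηh hB hV hBV hσ hσ0 hX hdet hε hΔ hXexp hηt hηh
    hηt0 hηt1 hηhM hεη hε'
  have hkn : k ≤ n := (hkl.trans hln).le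
  have hεη' : ε * (32 * (2 * m + 1) * M) ≤ ηt := by
    rwa [one_div, inv_mul_eq_div, le_div_iff₀ (by positivity)] at hεη
  have hεM : 8 * (ε * M) ≤ ηt := by
    have : 0 ≤ ε * M := by positivity
    nlinarith
  have hεm : 4 * (2 * m + 1) * ε ≤ 1 / 4 := by
    have : (2 * m + 1) * ε * 1 ≤ (2 * m + 1) * ε * M := by gcongr
    nlinarith
  subst hXexp
  have hP := ShrinkExpand.isOrthogonalResolution_blockProj hV k l
  have hA := ShrinkExpand.isExpansion_opCLM hV hkl hln (Δ := Δ) hdet hM1 hε (by linarith) hΔ.le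
    (hηt.symm.trans_le hηt1.le) (hηh.symm.trans_le (hηhM.trans (le_max_left _ _)))
  have hS := ShrinkExpand.mem_colSpan_sup_iff (X := X)
    (Y := V * (ShrinkExpand.midUnit n k l + (ε : ℂ) • Δ)) hdet
  have hfin := hA.finrank_eq hP hS
  rw [finrank_euclideanSpace_fin, finrank_euclideanSpace_fin, Nat.add_sub_of_le hkl.le] at hfin
  refine ⟨hfin, ?_⟩
  intro θ Z α hRR hα hgap hσα Xnew hXnew Vk hVk φ ψ hφ hψ
  have hBspec : ShrinkExpand.opCLM B = ShrinkExpand.spectralOp V σ := by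
    rw [ShrinkExpand.spectralOp, ← hBV, Matrix.mul_assoc,
      ShrinkExpand.mul_conjTranspose_self_of_unitary hV, Matrix.mul_one]
  have hVkiso : Vkᴴ * Vk = 1 := by
    rw [hVk]
    exact ShrinkExpand.submatrix_isometry (ShrinkExpand.conjTranspose_mul_self_of_unitary hV)
      (Fin.castLE_injective hkn)
  have hUk : Module.finrank ℂ (ShrinkExpand.colSpan Vk) = k :=
    ShrinkExpand.finrank_colSpan_of_isometry hVkiso
  have hXnew' : Xnew = Z.submatrix id (Fin.castLE hkl.le) := hXnew
  have hσle : ∀ i j : Fin n, i.1 ≤ j.1 → σ j ≤ σ i := fun i j h => hσ h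
  have hmain := ShrinkExpand.tan_principalAngle_ritz_le (B := ShrinkExpand.opCLM B)
    (Z := ShrinkExpand.opCLM Xnew) (U := ShrinkExpand.colSpan Vk) (m := m) (α := α)
    (s₀ := σ ⟨0, by omega⟩) (s₁ := σ ⟨k - 1, by omega⟩) (s₂ := σ ⟨k, by omega⟩)
    (s₃ := σ ⟨l, hln⟩) hP hA hS
    ((ShrinkExpand.finrank_range_blockProj_le hkl hln.le).trans_eq hfin.symm)
    (by rw [hVk]; exact ShrinkExpand.starProjection_colSpan_leadCols hV hkn)
    (fun h => by
      rw [h, finrank_bot] at hUk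
      omega)
    (by rw [hUk, finrank_euclideanSpace_fin])
    (by
      -- Otherwise `η̃ ≤ 4εM ≤ η̃/2`, against `η̃ > 0`.
      by_contra! hcon
      have h1 : ηt ≤ 4 * ε * M := by
        rw [hηt, ← ShrinkExpand.norm_opCLM]
        refine ContinuousLinearMap.opNorm_le_bound _ (by positivity) fun c => ?_
        rw [← ShrinkExpand.norm_blockProj_two_mul hV hkl]
        exact hcon c
      nlinarith)
    (fun s x => by rw [hBspec]; exact ShrinkExpand.spectralOp_blockProj_comm hV k l s σ x)
    (by
      rw [hBspec]
      exact ShrinkExpand.le_norm_spectralOp_blockProj_zero hV hσ0 (hσ0 _) fun i hi =>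
        hσle i ⟨k - 1, by omega⟩ (by simp only; omega))
    (by
      rw [hBspec]
      exact ShrinkExpand.norm_spectralOp_sub_blockProj_one_le hV (hσle _ _ hkl.le)
        fun i h1 h2 => ⟨hσle i ⟨l, hln⟩ h2.le, hσle ⟨k, hkl.trans hln⟩ i h1⟩)
    (by
      rw [hBspec]
      exact ShrinkExpand.norm_spectralOp_blockProj_two_le hV (hσ0 _).le fun i hi => by
        rw [abs_of_pos (hσ0 i)]
        exact hσle ⟨l, hln⟩ i hi)
    (hσ0 _) (hσ0 _).le (hσle _ _ hkl.le) (hσle _ _ (Nat.zero_le _)) hα hm0.le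
    ((div_le_iff₀ hα).1 (hσα.trans (le_max_left _ _))) hεm
    (ShrinkExpand.norm_opCLM_of_isometry (by
      rw [hXnew']
      exact ShrinkExpand.submatrix_isometry hRR.conjTranspose_mul_self
        (Fin.castLE_injective hkl.le)))
    (by rw [hXnew']; exact hRR.opCLM_mem _)
    (by
      rw [hXnew']
      -- Only the largest of the middle eigenvalues matters for the gap: `σ_{k+1}`, which has index
      -- `k` when counting from zero.
      exact hRR.exists_inner_eq_zero _ (add_pos (hσ0 _) hα) fun j =>
        (hgap (Fin.castLE hkl.le j) ⟨k, by omega⟩ j.2 le_rfl hkl).le)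
  have hBX : (ShrinkExpand.opCLM B).comp (ShrinkExpand.opCLM Xnew) =
      ShrinkExpand.opCLM (B * Xnew) := by
    ext1 x
    rw [ShrinkExpand.opCLM_mul]
    rfl
  rw [hBX, ← ShrinkExpand.colSpan_eq_range, ← ShrinkExpand.colSpan_eq_range, ← hφ, ← hψ] at hmain
  exact hmain
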